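/- All manifolds are finite-dimensional, either real smooth or complex (then "smooth" means holomorphic and "diffeomorphism" means biholomorphism), and submanifolds are embedded. Let $\Gamma\rightrightarrows M$ be a Lie groupoid with source $s$ and target $t$, where $\gamma\gamma'$ is defined when $t(\gamma)=s(\gamma')$. For $I,J\subset M$ write $\Gamma_I=s^{-1}(I)$ and $\Gamma_I^J=s^{-1}(I)\cap t^{-1}(J)$. Let $\mathcal S\subset M$ be a $\Gamma$-stable submanifold: $t(\gamma)\in\mathcal S\Leftrightarrow s(\gamma)\in\mathcal S$ for all $\gamma\in\Gamma$. A *$\Gamma$-resolution* of $\overline{\mathcal S}$ is a (Hausdorff) manifold $Z$ with a smooth map $\phi:Z\to M$ such that $\phi^{-1}(\mathcal S)$ is dense in $Z$, $\phi$ restricts to a diffeomorphism $\phi^{-1}(\mathcal S)\to\mathcal S$, and $(Z,\phi)$ carries a smooth right $\Gamma$-action $(z,\gamma)\mapsto z\cdot\gamma$, defined for $\phi(z)=s(\gamma)$, with $\phi(z\cdot\gamma)=t(\gamma)$. Let $L\subset M$ be a submanifold with $L\cap\mathcal S$ dense in $L$. The $\Gamma$-resolution $(Z,\phi)$ is *$L$-compatible*,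 with transversal submanifold $\tilde L$, if $\tilde L\subset Z$ is a submanifold such that $\phi$ restricts to a diffeomorphism $\tilde L\to L$, such that $T_z\tilde L+T_z(z\cdot\Gamma)=T_zZ$ for all $z\in\tilde L$, and such that $\tilde L$ meets all the $\Gamma$-orbits contained in $\phi^{-1}(\mathcal S)$. A Lie subgroupoid $R\rightrightarrows L$ of $\Gamma\rightrightarrows M$ is *closed* if $R$ is closed in $\Gamma_L^L$. It is *full in $\mathcal S$* if $L\cap\mathcal S$ is dense in $L$; $T_m\mathcal S=T_mF_m+T_mL$ for all $m\in L\cap\mathcal S$, where $F_m$ is the $\Gamma$-orbit of $m$; $L$ meets every $\Gamma$-orbit contained in $\mathcal S$; and $R_{L\cap\mathcal S}^{L\cap\mathcal S}=\Gamma_{L\cap\mathcal S}^{L\cap\mathcal S}$. In that case $Z(R)=R\backslash\Gamma_L$ denotes the quotient of $\Gamma_L$ by $\gamma\sim r\gamma$ ($r\in R$, $t(r)=s(\gamma)$), with the quotient topology, with the map $\phi_R:[\gamma]\mapsto t(\gamma)$ to $M$ and the right action $[\gamma]\cdot\gamma'=[\gamma\gamma']$. **Proposition.** Let $(Z,\phi)$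 be an $L$-compatible $\Gamma$-resolution of $\overline{\mathcal S}$ with transversal submanifold $\tilde L$, and let $\psi:L\to\tilde L$ be the inverse of $\phi_{|\tilde L}$. Then: 1. The set $R\subset\Gamma_L$ of all arrows $r\in\Gamma_L$ with $\psi(s(r))\cdot r\in\tilde L$ is a closed Lie subgroupoid $R\rightrightarrows L$ of $\Gamma\rightrightarrows M$, full in $\mathcal S$. 2. The $\Gamma$-orbit $\tilde L\cdot\Gamma$ of $\tilde L$ is an open subset of $Z$, and it coincides, as a $\Gamma$-resolution, with $(Z(R),\phi_R)$. That is, $Z(R)$ has a manifold structure for which $\Gamma_L\to Z(R)$ is a smooth submersion and $(Z(R),\phi_R)$ is a $\Gamma$-resolution of $\overline{\mathcal S}$, and $[\gamma]\mapsto\psi(s(\gamma))\cdot\gamma$ is a well-defined $\Gamma$-equivariant diffeomorphism, commuting with the maps to $M$, from $Z(R)$ onto the open subset $\tilde L\cdot\Gamma$ of $Z$. 3. If moreover $\tilde L$ meets all the $\Gamma$-orbits of $Z$, then $(Z,\phi)$ and $(Z(R),\phi_R)$ coincide: the map of part 2 is an isomorphism of $\Gamma$-resolutions from $Z(R)$ onto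 $Z$. -/

import Mathlib

open scoped Manifold ContDiff Topology Pointwise

/-! All manifolds are finite dimensional, without boundary, over `𝕜 = ℝ` (smooth case) or `𝕜 = ℂ`
(holomorphic case: over `ℂ`, being `C^∞` in the sense of complex derivatives is being
holomorphic). -/

section Submanifolds

variable {𝕜 : Type*} [RCLike 𝕜]

/-- A map `f : A → Y` on a subset `A` of a manifold `X` is smooth (holomorphic) if near every point
of `A` it extends to a smooth (holomorphic) map on `X`. For an embedded submanifold `A` this is
smoothness for the induced manifold structure of `A`. -/
def SmoothOnSubset {E H E' H' X Y : Type*}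
    [NormedAddCommGroup E] [NormedSpace 𝕜 E] [TopologicalSpace H] (I : ModelWithCorners 𝕜 E H)
    [NormedAddCommGroup E'] [NormedSpace 𝕜 E'] [TopologicalSpace H'] (J : ModelWithCorners 𝕜 E' H')
    [TopologicalSpace X] [ChartedSpace H X] [TopologicalSpace Y] [ChartedSpace H' Y]
    (A : Set X) (f : A → Y) : Prop :=
  ∀ x : A, ∃ g : X → Y, ContMDiffAt I J ∞ g (x : X) ∧ ∀ᶠ y : A in 𝓝 x, g (y : X) = f y

variable {E X E' Y : Type*} [NormedAddCommGroup E] [NormedSpace 𝕜 E]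
  [TopologicalSpace X] [ChartedSpace E X]
  [NormedAddCommGroup E'] [NormedSpace 𝕜 E'] [TopologicalSpace Y] [ChartedSpace E' Y]

/-- Embedded submanifolds, through slice charts: around each of its points, `A` is given in some
chart of `X` by a fixed linear subspace `F` of the model space. -/
def IsEmbeddedSubmanifold (𝕜 : Type*) [RCLike 𝕜] {E X : Type*} [NormedAddCommGroup E]
    [NormedSpace 𝕜 E] [TopologicalSpace X] [ChartedSpace E X] (A : Set X) : Prop :=
  ∃ F : Submodule 𝕜 E, ∀ x ∈ A, ∃ e ∈ IsManifold.maximalAtlas 𝓘(𝕜, E) ∞ X,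
    x ∈ e.source ∧ ∀ y ∈ e.source, (y ∈ A ↔ e y ∈ F)

/-- `f` restricts to a diffeomorphism (biholomorphism) from the subset `A` to the subset `B`. -/
def IsDiffeoBetween (𝕜 : Type*) [RCLike 𝕜] {E X E' Y : Type*} [NormedAddCommGroup E]
    [NormedSpace 𝕜 E] [TopologicalSpace X] [ChartedSpace E X]
    [NormedAddCommGroup E'] [NormedSpace 𝕜 E'] [TopologicalSpace Y] [ChartedSpace E' Y]
    (f : X → Y) (A : Set X) (B : Set Y) : Prop :=
  Set.BijOn f A B ∧
  SmoothOnSubset 𝓘(𝕜, E) 𝓘(𝕜, E') A (fun x => f x) ∧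
  ∃ g : B → X, (∀ b : B, g b ∈ A ∧ f (g b) = b) ∧ SmoothOnSubset 𝓘(𝕜, E') 𝓘(𝕜, E) B g

/-- The curve `c`, defined near `0 ∈ 𝕜`, is smooth at `0`. -/
def SmoothCurve (𝕜 : Type*) [RCLike 𝕜] {E X : Type*} [NormedAddCommGroup E]
    [NormedSpace 𝕜 E] [TopologicalSpace X] [ChartedSpace E X] (c : 𝕜 → X) : Prop :=
  ContMDiffAt 𝓘(𝕜, 𝕜) 𝓘(𝕜, E) ∞ c 0

/-- The curve `c` passes through `x` at time `0` with velocity `v`. -/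
def HasVelocity (c : 𝕜 → X) (x : X) (v : TangentSpace 𝓘(𝕜, E) x) : Prop :=
  tangentMap 𝓘(𝕜, 𝕜) 𝓘(𝕜, E) c ⟨0, (1 : 𝕜)⟩ = (⟨x, v⟩ : TangentBundle 𝓘(𝕜, E) X)

/-- The tangent space `T_x A` of a submanifold `A` of `X`, as a subset of `T_x X`: the velocities
of the smooth curves in `A` through `x`. -/
def tangentVectors (𝕜 : Type*) [RCLike 𝕜] {E X : Type*} [NormedAddCommGroup E]
    [NormedSpace 𝕜 E] [TopologicalSpace X] [ChartedSpace E X] (A : Set X) (x : X) :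
    Set (TangentSpace 𝓘(𝕜, E) x) :=
  {v | ∃ c : 𝕜 → X, SmoothCurve (E := E) 𝕜 c ∧ (∀ᶠ ε in 𝓝 (0 : 𝕜), c ε ∈ A) ∧ HasVelocity c x v}

/-- For submanifolds `A ⊆ X` and `B ⊆ Y`, a smooth map `f : A → Y` with values in `B` is a
submersion `A → B`: its differential `T_x A → T_{f x} B` is onto for every `x ∈ A`. -/
def IsSubmersionBetween (𝕜 : Type*) [RCLike 𝕜] {E X E' Y : Type*} [NormedAddCommGroup E]
    [NormedSpace 𝕜 E] [TopologicalSpace X] [ChartedSpace E X]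
    [NormedAddCommGroup E'] [NormedSpace 𝕜 E'] [TopologicalSpace Y] [ChartedSpace E' Y]
    (A : Set X) (f : A → Y) (B : Set Y) : Prop :=
  ∀ x : A, ∀ v ∈ tangentVectors (E := E') 𝕜 B (f x),
    ∃ c : 𝕜 → A, c 0 = x ∧ SmoothCurve (E := E) 𝕜 (fun ε => (c ε : X)) ∧
      HasVelocity (fun ε => f (c ε)) (f x) v

end Submanifolds

/-- A Lie groupoid `Γ ⇉ M`. The product `mul γ γ'` is meaningful when `tgt γ = src γ'`; its values
on other pairs are irrelevant. -/
structure LieGroupoid (𝕜 : Type*) [RCLike 𝕜] {EΓ EM : Type*} (Γ M : Type*)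
    [NormedAddCommGroup EΓ] [NormedSpace 𝕜 EΓ] [NormedAddCommGroup EM] [NormedSpace 𝕜 EM]
    [TopologicalSpace Γ] [ChartedSpace EΓ Γ] [TopologicalSpace M] [ChartedSpace EM M] where
  src : Γ → M
  tgt : Γ → M
  unit : M → Γ
  inv : Γ → Γ
  mul : Γ → Γ → Γ
  src_unit : ∀ m, src (unit m) = m
  tgt_unit : ∀ m, tgt (unit m) = m
  src_inv : ∀ γ, src (inv γ) = tgt γ
  tgt_inv : ∀ γ, tgt (inv γ) = src γ
  src_mul : ∀ γ γ', tgt γ = src γ' → src (mul γ γ') = src γ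
  tgt_mul : ∀ γ γ', tgt γ = src γ' → tgt (mul γ γ') = tgt γ'
  mul_assoc : ∀ γ γ' γ'', tgt γ = src γ' → tgt γ' = src γ'' →
    mul (mul γ γ') γ'' = mul γ (mul γ' γ'')
  unit_mul : ∀ γ, mul (unit (src γ)) γ = γ
  mul_unit : ∀ γ, mul γ (unit (tgt γ)) = γ
  mul_inv : ∀ γ, mul γ (inv γ) = unit (src γ)
  inv_mul : ∀ γ, mul (inv γ) γ = unit (tgt γ)
  smooth_src : ContMDiff 𝓘(𝕜, EΓ) 𝓘(𝕜, EM) ∞ src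
  smooth_tgt : ContMDiff 𝓘(𝕜, EΓ) 𝓘(𝕜, EM) ∞ tgt
  submersion_src : Manifold.IsSubmersion 𝓘(𝕜, EΓ) 𝓘(𝕜, EM) ∞ src
  submersion_tgt : Manifold.IsSubmersion 𝓘(𝕜, EΓ) 𝓘(𝕜, EM) ∞ tgt
  smooth_unit : ContMDiff 𝓘(𝕜, EM) 𝓘(𝕜, EΓ) ∞ unit
  smooth_inv : ContMDiff 𝓘(𝕜, EΓ) 𝓘(𝕜, EΓ) ∞ inv
  smooth_mul : SmoothOnSubset (𝓘(𝕜, EΓ).prod 𝓘(𝕜, EΓ)) 𝓘(𝕜, EΓ)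
    {p : Γ × Γ | tgt p.1 = src p.2} (fun p => mul p.1.1 p.1.2)

namespace LieGroupoid

variable {𝕜 : Type*} [RCLike 𝕜] {EΓ EM EZ Γ M Z : Type*}
  [NormedAddCommGroup EΓ] [NormedSpace 𝕜 EΓ] [NormedAddCommGroup EM] [NormedSpace 𝕜 EM]
  [NormedAddCommGroup EZ] [NormedSpace 𝕜 EZ]
  [TopologicalSpace Γ] [ChartedSpace EΓ Γ] [TopologicalSpace M] [ChartedSpace EM M]
  [TopologicalSpace Z] [ChartedSpace EZ Z]
  (G : LieGroupoid 𝕜 (EΓ := EΓ) (EM := EM) Γ M)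

/-- `S ⊆ M` is `Γ`-stable. -/
def IsStable (S : Set M) : Prop := ∀ γ, G.tgt γ ∈ S ↔ G.src γ ∈ S

/-- `Γ_L`, the arrows with source in `L`. -/
def srcIn (L : Set M) : Set Γ := {γ | G.src γ ∈ L}

/-- `Γ_L^L'`, the arrows with source in `L` and target in `L'`. -/
def between (L L' : Set M) : Set Γ := {γ | G.src γ ∈ L ∧ G.tgt γ ∈ L'}

/-- `act` is a (smooth) right action of `Γ ⇉ M` on `φ : Z → M`. The point `act z γ = z · γ` is
meaningful when `φ z = src γ`; other values of `act` are irrelevant. -/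
structure IsRightModule (φ : Z → M) (act : Z → Γ → Z) : Prop where
  smooth : ContMDiff 𝓘(𝕜, EZ) 𝓘(𝕜, EM) ∞ φ
  map_act : ∀ z γ, φ z = G.src γ → φ (act z γ) = G.tgt γ
  act_unit : ∀ z, act z (G.unit (φ z)) = z
  act_mul : ∀ z γ γ', φ z = G.src γ → G.tgt γ = G.src γ' →
    act z (G.mul γ γ') = act (act z γ) γ'
  smooth_act : SmoothOnSubset (𝓘(𝕜, EZ).prod 𝓘(𝕜, EΓ)) 𝓘(𝕜, EZ)
    {p : Z × Γ | φ p.1 = G.src p.2} (fun p => act p.1.1 p.1.2)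

end LieGroupoid

/-- `φ : Z → M` is a resolution of the closure of the submanifold `S` of `M`. -/
structure IsResolution (𝕜 : Type*) [RCLike 𝕜] {EM EZ M Z : Type*}
    [NormedAddCommGroup EM] [NormedSpace 𝕜 EM] [NormedAddCommGroup EZ] [NormedSpace 𝕜 EZ]
    [TopologicalSpace M] [ChartedSpace EM M] [TopologicalSpace Z] [ChartedSpace EZ Z]
    (S : Set M) (φ : Z → M) : Prop where
  smooth : ContMDiff 𝓘(𝕜, EZ) 𝓘(𝕜, EM) ∞ φ
  dense : Dense (φ ⁻¹' S)
  diffeo : IsDiffeoBetween (E := EZ) (E' := EM) 𝕜 φ (φ ⁻¹' S) S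

namespace LieGroupoid

variable {𝕜 : Type*} [RCLike 𝕜] {EΓ EM EZ Γ M Z : Type*}
  [NormedAddCommGroup EΓ] [NormedSpace 𝕜 EΓ] [NormedAddCommGroup EM] [NormedSpace 𝕜 EM]
  [NormedAddCommGroup EZ] [NormedSpace 𝕜 EZ]
  [TopologicalSpace Γ] [ChartedSpace EΓ Γ] [TopologicalSpace M] [ChartedSpace EM M]
  [TopologicalSpace Z] [ChartedSpace EZ Z]
  (G : LieGroupoid 𝕜 (EΓ := EΓ) (EM := EM) Γ M)

/-- `(Z, φ)` with the action `act` is a `Γ`-resolution of the closure of `S`. -/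
def IsEquivariantResolution (S : Set M) (φ : Z → M) (act : Z → Γ → Z) : Prop :=
  G.IsRightModule (EZ := EZ) φ act ∧ IsResolution (EM := EM) (EZ := EZ) 𝕜 S φ

/-- The tangent space at `z` of the `Γ`-orbit of `z` in the right module `(Z, φ)`: the velocities
at `0` of the curves `ε ↦ z · γ(ε)`, for `γ` a smooth curve in the source fibre over `φ z` with
`γ(0)` the unit at `φ z`. This is the image of the infinitesimal action of the Lie algebroid. -/
def orbitTangentVectors (φ : Z → M) (act : Z → Γ → Z) (z : Z) :
    Set (TangentSpace 𝓘(𝕜, EZ) z) :=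
  {v | ∃ c : 𝕜 → Γ, c 0 = G.unit (φ z) ∧ SmoothCurve (E := EΓ) 𝕜 c ∧
    (∀ᶠ ε in 𝓝 (0 : 𝕜), G.src (c ε) = φ z) ∧ HasVelocity (fun ε => act z (c ε)) z v}

/-- The tangent space at `m` of the `Γ`-orbit `F_m` of `m ∈ M`, that is, the orbit of `m` for the
right action `m · γ = tgt γ` on `M`. -/
def baseOrbitTangentVectors (m : M) : Set (TangentSpace 𝓘(𝕜, EM) m) :=
  G.orbitTangentVectors (fun m : M => m) (fun _ γ => G.tgt γ) m

/-- `R ⇉ L` is a Lie subgroupoid of `Γ ⇉ M`. -/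
structure IsLieSubgroupoid (R : Set Γ) (L : Set M) : Prop where
  submanifold_arrows : IsEmbeddedSubmanifold (E := EΓ) 𝕜 R
  submanifold_units : IsEmbeddedSubmanifold (E := EM) 𝕜 L
  src_mem : ∀ r ∈ R, G.src r ∈ L
  tgt_mem : ∀ r ∈ R, G.tgt r ∈ L
  unit_mem : ∀ m ∈ L, G.unit m ∈ R
  inv_mem : ∀ r ∈ R, G.inv r ∈ R
  mul_mem : ∀ r ∈ R, ∀ r' ∈ R, G.tgt r = G.src r' → G.mul r r' ∈ R
  submersion_src : IsSubmersionBetween (E := EΓ) (E' := EM) 𝕜 R (fun r => G.src r) L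
  submersion_tgt : IsSubmersionBetween (E := EΓ) (E' := EM) 𝕜 R (fun r => G.tgt r) L

/-- `R ⇉ L` is closed: `R` is a closed subset of `Γ_L^L`. -/
def IsClosedSubgroupoid (R : Set Γ) (L : Set M) : Prop :=
  IsClosed {γ : G.between L L | (γ : Γ) ∈ R}

/-- `L` intersects transversally the `Γ`-orbits contained in `S`. -/
def IntersectsTransversally (L S : Set M) : Prop :=
  ∀ m ∈ L ∩ S, tangentVectors (E := EM) 𝕜 S m =
    G.baseOrbitTangentVectors m + tangentVectors (E := EM) 𝕜 L m

/-- `R ⇉ L` is a Lie subgroupoid in `S`. -/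
structure IsLieSubgroupoidIn (R : Set Γ) (L S : Set M) : Prop where
  isLieSubgroupoid : G.IsLieSubgroupoid R L
  dense : L ⊆ closure (L ∩ S)
  transverse : G.IntersectsTransversally L S
  meets_orbits : ∀ m ∈ S, ∃ γ, G.src γ = m ∧ G.tgt γ ∈ L

/-- `R ⇉ L` is a Lie subgroupoid full in `S`. -/
def IsLieSubgroupoidFullIn (R : Set Γ) (L S : Set M) : Prop :=
  G.IsLieSubgroupoidIn R L S ∧ R ∩ G.between (L ∩ S) (L ∩ S) = G.between (L ∩ S) (L ∩ S)

/-- `(Z, φ)` is `L`-compatible (relatively to `S`), with transversal submanifold `L' ⊆ Z`. -/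
structure IsCompatible (S : Set M) (φ : Z → M) (act : Z → Γ → Z) (L : Set M) (L' : Set Z) :
    Prop where
  submanifold : IsEmbeddedSubmanifold (E := EZ) 𝕜 L'
  diffeo : IsDiffeoBetween (E := EZ) (E' := EM) 𝕜 φ L' L
  transverse : ∀ z ∈ L',
    tangentVectors (E := EZ) 𝕜 L' z + G.orbitTangentVectors φ act z = Set.univ
  meets_orbits : ∀ z, φ z ∈ S → ∃ γ, G.src γ = φ z ∧ act z γ ∈ L'

/-- The `Γ`-orbit of a subset of a right module. -/
def orbitOf (φ : Z → M) (act : Z → Γ → Z) (A : Set Z) : Set Z :=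
  {w | ∃ z ∈ A, ∃ γ, φ z = G.src γ ∧ w = act z γ}

/-- The set of arrows `r ∈ Γ_L` with `ψ (src r) · r ∈ L'`. -/
def returnArrows (act : Z → Γ → Z) (L : Set M) (L' : Set Z) (ψ : L → Z) : Set Γ :=
  {r | ∃ h : G.src r ∈ L, act (ψ ⟨G.src r, h⟩) r ∈ L'}

/-- The quotient space `Z(R) = R \ Γ_L`, which identifies `γ` with `r γ` for `r ∈ R`. It carries the
quotient topology. -/
abbrev LeftQuotient (R : Set Γ) (L : Set M) : Type _ :=
  Quot (fun γ' γ : G.srcIn L => ∃ r ∈ R, G.tgt r = G.src γ ∧ (γ' : Γ) = G.mul r γ)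

/-- The class in `Z(R)` of an element of `Γ_L`. -/
def toLeftQuotient (R : Set Γ) (L : Set M) (γ : G.srcIn L) : G.LeftQuotient R L := Quot.mk _ γ

/-- The map `φ_R : Z(R) → M` induced by the target map. -/
def leftQuotientMap (R : Set Γ) (L : Set M) : G.LeftQuotient R L → M :=
  Quot.lift (fun γ => G.tgt γ) (by
    rintro γ' γ ⟨r, -, h, h'⟩
    show G.tgt γ' = G.tgt γ
    rw [h', G.tgt_mul r γ h])

/-- The given charts and action are the manifold structure and the right action of `Γ` on the
quotient `Z(R) = R \ Γ_L`: the projection `Γ_L → Z(R)` is a submersion, and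
`[γ] · γ' = [γ γ']`. -/
structure IsQuotientModule (R : Set Γ) (L : Set M) [ChartedSpace EZ (G.LeftQuotient R L)]
    (act : G.LeftQuotient R L → Γ → G.LeftQuotient R L) : Prop where
  isManifold : IsManifold 𝓘(𝕜, EZ) ∞ (G.LeftQuotient R L)
  t2 : T2Space (G.LeftQuotient R L)
  smooth_proj : SmoothOnSubset 𝓘(𝕜, EΓ) 𝓘(𝕜, EZ) (G.srcIn L) (G.toLeftQuotient R L)
  submersion_proj : IsSubmersionBetween (E := EΓ) (E' := EZ) 𝕜
    (G.srcIn L) (G.toLeftQuotient R L) Set.univ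
  act_proj : ∀ (γ : G.srcIn L) (γ' : Γ) (h : G.tgt γ = G.src γ'),
    act (G.toLeftQuotient R L γ) γ' =
      G.toLeftQuotient R L ⟨G.mul γ γ', by
        show G.src (G.mul γ γ') ∈ L
        rw [G.src_mul γ γ' h]
        exact γ.2⟩

/-- `Φ` is an isomorphism from the `Γ`-module `(W, φW)` onto the open subset `U` of the `Γ`-module
`(Z, φ)`: an equivariant diffeomorphism `W → U` over `M`. With `U = Z`, for two `Γ`-resolutions,
it is an isomorphism of `Γ`-resolutions. -/
structure IsModuleIsoOnto {W : Type*} [TopologicalSpace W] [ChartedSpace EZ W]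
    (φW : W → M) (actW : W → Γ → W) (φ : Z → M) (act : Z → Γ → Z) (Φ : W → Z) (U : Set Z) :
    Prop where
  isOpen : IsOpen U
  diffeo : IsDiffeoBetween (E := EZ) (E' := EZ) 𝕜 Φ Set.univ U
  map_comp : ∀ w, φ (Φ w) = φW w
  equivariant : ∀ w γ, φW w = G.src γ → Φ (actW w γ) = act (Φ w) γ

end LieGroupoid

/-! Everything is read off from one map, `translate`: `Γ_L → Z`, `γ ↦ ψ(s γ)·γ`.

It is a submersion. At the unit over `m ∈ L`, the units along `L` sweep out the directions tangent
to `L'`, and the arrows in the source fibre sweep out the orbit directions; transversality says that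
together these fill the tangent space of `Z` at `ψ m`. Right translation carries this from units to
every `γ ∈ Γ_L`. The form used is the existence of smooth local sections
(`exists_translate_section`). Hence `translate` is open, and its image `L'·Γ` is open in `Z`.

Its fibres are the classes of `R`: if `γ` and `γ'` have the same image, then `γγ'⁻¹` brings `ψ(s γ)`
back to `L'`, so it lies in `R`. Thus the induced map `Z(R) → Z` is an open embedding
(`isOpenEmbedding_quotientMap`). The charts of `Z(R)` are pulled back along it, and the Hausdorff
property, the smooth action and the resolution property are inherited from `Z`.

The set `R` is the preimage of `L'` under `translate`. Since orbit directions fill the normal space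
of `L'`, the source together with the component of `translate` normal to `L'` is a submersion near
`R` (`exists_submersion_of_mem_returnArrows`); this gives both the submanifold structure and the
submersivity of the source map, and inversion gives that of the target. Inside `Γ_L^L`, `R` is where
two continuous maps to the Hausdorff space `Z` agree, so it is closed. It is full in `S` because `φ`
is injective over `S`, and `L` is transverse to the orbits in `S` because `φ` pushes the
decomposition of the tangent space of `Z` forward. -/

/-! ### Inverse functions and submersions to vector spaces -/

section InverseFunction

variable {𝕜 : Type*} [RCLike 𝕜] {E V X : Type*} [NormedAddCommGroup E] [NormedSpace 𝕜 E]
  [NormedAddCommGroup V] [NormedSpace 𝕜 V] [TopologicalSpace X] [ChartedSpace E X]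

/-- The inverse function theorem, with smoothness of both directions on whole neighbourhoods. -/
theorem exists_openPartialHomeomorph_contDiffOn [CompleteSpace E] {T : E → E} {O : Set E}
    (hO : IsOpen O) {u : E} (hu : u ∈ O) (hT : ContDiffOn 𝕜 ∞ T O)
    (hd : HasFDerivAt T (ContinuousLinearMap.id 𝕜 E) u) :
    ∃ θ : OpenPartialHomeomorph E E, u ∈ θ.source ∧ θ.source ⊆ O ∧ (∀ y, θ y = T y) ∧
      ContDiffOn 𝕜 ∞ θ θ.source ∧ ContDiffOn 𝕜 ∞ θ.symm θ.target := by
  have hTu : ContDiffAt 𝕜 ∞ T u := hT.contDiffAt (hO.mem_nhds hu)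
  have hd' : HasFDerivAt T ((ContinuousLinearEquiv.refl 𝕜 E : E ≃L[𝕜] E) : E →L[𝕜] E) u := hd
  let θ₀ := hTu.toOpenPartialHomeomorph T hd' (by simp)
  -- Smoothness of the inverse at a point needs an invertible derivative there, so the domain is cut
  -- down to the open set where the derivative is invertible.
  let N : Set E := O ∩ (fderiv 𝕜 T) ⁻¹'
    (Set.range ((↑) : (E ≃L[𝕜] E) → E →L[𝕜] E))
  have hN : IsOpen N :=
    (hT.continuousOn_fderiv_of_isOpen hO (by simp)).isOpen_inter_preimage hO
      ContinuousLinearEquiv.isOpen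
  have huN : u ∈ N := ⟨hu, ⟨ContinuousLinearEquiv.refl 𝕜 E, hd'.fderiv.symm⟩⟩
  refine ⟨θ₀.restrOpen N hN, ?_, ?_, fun _ => rfl, ?_, ?_⟩
  · exact ⟨hTu.mem_toOpenPartialHomeomorph_source hd' (by simp), huN⟩
  · exact fun y hy => hy.2.1
  · exact hT.mono fun y hy => hy.2.1
  · intro y hy
    have hyN : (θ₀.restrOpen N hN).symm y ∈ (θ₀.restrOpen N hN).source :=
      (θ₀.restrOpen N hN).map_target hy
    obtain ⟨f', hf'⟩ := hyN.2.2
    have hc : ContDiffAt 𝕜 ∞ T ((θ₀.restrOpen N hN).symm y) :=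
      hT.contDiffAt (hO.mem_nhds hyN.2.1)
    refine (OpenPartialHomeomorph.contDiffAt_symm (θ₀.restrOpen N hN) (f₀' := f') hy ?_
      hc).contDiffWithinAt
    rw [hf']
    exact (hc.differentiableAt (by simp)).hasFDerivAt

/-- A map to a vector space which is a submersion at `x` is linear in a suitable chart. -/
theorem exists_chart_eq_linear [FiniteDimensional 𝕜 E] [FiniteDimensional 𝕜 V]
    [IsManifold 𝓘(𝕜, E) ∞ X] {h : X → V} {U : Set X} (hU : IsOpen U) {x : X} (hx : x ∈ U)
    (hh : ContMDiffOn 𝓘(𝕜, E) 𝓘(𝕜, V) ∞ h U)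
    (hs : Function.Surjective (mfderiv 𝓘(𝕜, E) 𝓘(𝕜, V) h x)) :
    ∃ e ∈ IsManifold.maximalAtlas 𝓘(𝕜, E) ∞ X, x ∈ e.source ∧ e.source ⊆ U ∧
      ∃ π : E →L[𝕜] V, Function.Surjective π ∧ ∀ y ∈ e.source, π (e y) = h y := by
  have := FiniteDimensional.complete 𝕜 E
  set c := chartAt E x with hc
  have hcA : c ∈ IsManifold.maximalAtlas 𝓘(𝕜, E) ∞ X := IsManifold.chart_mem_maximalAtlas x
  have hxc : x ∈ c.source := mem_chart_source E x
  let π : E →L[𝕜] V := mfderiv 𝓘(𝕜, E) 𝓘(𝕜, V) h x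
  have hπ : Function.Surjective π := hs
  obtain ⟨q, hq⟩ := ContinuousLinearMap.exists_rightInverse_of_surjective π
    (LinearMap.range_eq_top.2 hπ)
  have hq' : ∀ v, π (q v) = v := fun v => DFunLike.congr_fun hq v
  let O : Set E := c.target ∩ c.symm ⁻¹' U
  have hO : IsOpen O := c.symm.isOpen_inter_preimage hU
  have hxO : c x ∈ O := ⟨c.map_source hxc, by simpa [c.left_inv hxc] using hx⟩
  have hhc : ContDiffOn 𝕜 ∞ (h ∘ c.symm) O := by
    rw [← contMDiffOn_iff_contDiffOn]
    exact hh.comp ((contMDiffOn_symm_of_mem_maximalAtlas hcA).mono fun y hy => hy.1)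
      fun y hy => hy.2
  have hder : HasFDerivAt (h ∘ c.symm) π (c x) := by
    have h1 : MDifferentiableAt 𝓘(𝕜, E) 𝓘(𝕜, V) h x :=
      (hh.contMDiffAt (hU.mem_nhds hx)).mdifferentiableAt (by simp)
    have h2 := h1.hasMFDerivAt.2
    simp only [writtenInExtChartAt, mfld_simps] at h2
    exact hasFDerivWithinAt_univ.1 h2
  -- As `π ∘ q = id`, one has `π (T u) = h (c.symm u)` exactly, while the correction has zero
  -- derivative at `c x`. So `T` is a change of coordinates that turns `h` into `π`.
  let T : E → E := fun u => u + q ((h ∘ c.symm) u - π u)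
  have hT : ContDiffOn 𝕜 ∞ T O :=
    contDiffOn_id.add (q.contDiff.comp_contDiffOn (hhc.sub π.contDiff.contDiffOn))
  have hTd : HasFDerivAt T (ContinuousLinearMap.id 𝕜 E) (c x) := by
    have := (hasFDerivAt_id (𝕜 := 𝕜) (c x)).add
      (q.hasFDerivAt.comp (c x) (hder.sub π.hasFDerivAt))
    exact this.congr_fderiv (by simp)
  obtain ⟨θ, h1, h2, h3, h4, h5⟩ := exists_openPartialHomeomorph_contDiffOn hO hxO hT hTd
  refine ⟨c.trans θ, ?_, ?_, ?_, π, hπ, ?_⟩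
  · apply OpenPartialHomeomorph.mem_maximalAtlas_of_contMDiffOn
    · exact (contMDiffOn_iff_contDiffOn.2 h4).comp
        ((contMDiffOn_of_mem_maximalAtlas hcA).mono (by simp)) (by simp)
    · exact (contMDiffOn_symm_of_mem_maximalAtlas hcA).comp
        ((contMDiffOn_iff_contDiffOn.2 h5).mono (by simp)) (by simp)
  · simpa using ⟨hxc, h1⟩
  · intro y hy
    have hy' : y ∈ c.source ∧ c y ∈ θ.source := by simpa using hy
    have := (h2 hy'.2).2
    simpa [c.left_inv hy'.1] using this
  · intro y hy
    have hy' : y ∈ c.source ∧ c y ∈ θ.source := by simpa using hy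
    simp [h3, T, hq', c.left_inv hy'.1]

/-- A submersion to a vector space has local smooth sections. -/
theorem exists_local_section [FiniteDimensional 𝕜 E] [FiniteDimensional 𝕜 V]
    [IsManifold 𝓘(𝕜, E) ∞ X] {h : X → V} {U : Set X} (hU : IsOpen U) {x : X} (hx : x ∈ U)
    (hh : ContMDiffOn 𝓘(𝕜, E) 𝓘(𝕜, V) ∞ h U)
    (hs : Function.Surjective (mfderiv 𝓘(𝕜, E) 𝓘(𝕜, V) h x)) :
    ∃ σ : V → X, ContMDiffAt 𝓘(𝕜, V) 𝓘(𝕜, E) ∞ σ (h x) ∧ σ (h x) = x ∧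
      ∀ᶠ v in 𝓝 (h x), h (σ v) = v := by
  obtain ⟨e, he, hxe, -, π, hπ, hπe⟩ := exists_chart_eq_linear hU hx hh hs
  obtain ⟨q, hq⟩ := ContinuousLinearMap.exists_rightInverse_of_surjective π
    (LinearMap.range_eq_top.2 hπ)
  have hq' : ∀ v, π (q v) = v := fun v => DFunLike.congr_fun hq v
  let s : V → E := fun v => e x + q (v - h x)
  have hsx : s (h x) = e x := by simp [s]
  have hsd : ContDiff 𝕜 ∞ s := contDiff_const.add (q.contDiff.comp (contDiff_id.sub contDiff_const))
  refine ⟨e.symm ∘ s, ?_, by simp [hsx, e.left_inv hxe], ?_⟩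
  · refine ContMDiffAt.comp (h x) ?_ hsd.contMDiff.contMDiffAt
    rw [hsx]
    exact contMDiffAt_symm_of_mem_maximalAtlas he (e.map_source hxe)
  · have : ∀ᶠ v in 𝓝 (h x), s v ∈ e.target :=
      hsd.continuous.continuousAt.eventually (by
        rw [hsx]; exact e.open_target.mem_nhds (e.map_source hxe))
    filter_upwards [this] with v hv
    simp only [Function.comp_apply]
    rw [← hπe _ (e.map_target hv), e.right_inv hv]
    simp [s, hq', hπe x hxe]

end InverseFunction

/-! ### Velocities of curves and their images under smooth maps -/

section Velocity

variable {𝕜 : Type*} [RCLike 𝕜] {E V X E' Y : Type*} [NormedAddCommGroup E] [NormedSpace 𝕜 E]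
  [NormedAddCommGroup V] [NormedSpace 𝕜 V] [TopologicalSpace X] [ChartedSpace E X]
  [NormedAddCommGroup E'] [NormedSpace 𝕜 E'] [TopologicalSpace Y] [ChartedSpace E' Y]

/-- The map `F` need only agree with `f ∘ k` near `n`, so it may take arbitrary values where `k`
leaves `A`. -/
theorem SmoothOnSubset.contMDiffAt_comp {E₁ H₁ E₂ H₂ E₃ H₃ X Y N : Type*}
    [NormedAddCommGroup E₁] [NormedSpace 𝕜 E₁] [TopologicalSpace H₁] {I : ModelWithCorners 𝕜 E₁ H₁}
    [NormedAddCommGroup E₂] [NormedSpace 𝕜 E₂] [TopologicalSpace H₂] {J : ModelWithCorners 𝕜 E₂ H₂}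
    [NormedAddCommGroup E₃] [NormedSpace 𝕜 E₃] [TopologicalSpace H₃] {K : ModelWithCorners 𝕜 E₃ H₃}
    [TopologicalSpace X] [ChartedSpace H₁ X] [TopologicalSpace Y] [ChartedSpace H₂ Y]
    [TopologicalSpace N] [ChartedSpace H₃ N]
    {A : Set X} {f : A → Y} (hf : SmoothOnSubset I J A f) {k : N → X} {n : N}
    (hk : ContMDiffAt K I ∞ k n) {F : N → Y}
    (hF : ∀ᶠ m in 𝓝 n, ∃ h : k m ∈ A, F m = f ⟨k m, h⟩) : ContMDiffAt K J ∞ F n := by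
  obtain ⟨hn, -⟩ := hF.self_of_nhds
  obtain ⟨g, hg, hgf⟩ := hf ⟨k n, hn⟩
  refine (ContMDiffAt.comp n hg hk).congr_of_eventuallyEq ?_
  rw [nhds_subtype_eq_comap, Filter.eventually_comap] at hgf
  filter_upwards [hF, hk.continuousAt.eventually hgf] with m ⟨hm, hm'⟩ hm''
  rw [hm', Function.comp_apply, hm'' ⟨k m, hm⟩ rfl]

/-- Equality in the tangent bundle is split into base point and vector; both vectors are read in the
model space `E`, which avoids transport along `c 0 = x`. -/
theorem hasVelocity_iff {c : 𝕜 → X} {x : X} {v : TangentSpace 𝓘(𝕜, E) x} :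
    HasVelocity c x v ↔
      c 0 = x ∧ (show E from mfderiv 𝓘(𝕜, 𝕜) 𝓘(𝕜, E) c 0 (1 : 𝕜)) = (show E from v) := by
  unfold HasVelocity tangentMap
  constructor
  · intro h
    obtain ⟨h1, h2⟩ := (Bundle.TotalSpace.mk.injEq _ _ _ _).mp h
    exact ⟨h1, eq_of_heq h2⟩
  · rintro ⟨rfl, h⟩
    exact congrArg (Bundle.TotalSpace.mk (c 0)) h

theorem HasVelocity.base {c : 𝕜 → X} {x : X} {v : TangentSpace 𝓘(𝕜, E) x}
    (h : HasVelocity c x v) : c 0 = x := (hasVelocity_iff.1 h).1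

theorem HasVelocity.congr {c c' : 𝕜 → X} {x : X} {v : TangentSpace 𝓘(𝕜, E) x}
    (h : HasVelocity c x v) (hc : c' =ᶠ[𝓝 0] c) : HasVelocity c' x v := by
  rw [hasVelocity_iff] at h ⊢
  rw [← h.2, ← h.1]
  refine ⟨hc.self_of_nhds, ?_⟩
  exact DFunLike.congr_fun (F := 𝕜 →L[𝕜] E) hc.mfderiv_eq (1 : 𝕜)

theorem SmoothCurve.mdifferentiableAt {c : 𝕜 → X} (hc : SmoothCurve (E := E) 𝕜 c) :
    MDifferentiableAt 𝓘(𝕜, 𝕜) 𝓘(𝕜, E) c 0 :=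
  ContMDiffAt.mdifferentiableAt hc (by simp)

theorem SmoothCurve.hasVelocity {c : 𝕜 → X} {x : X} (hx : c 0 = x) :
    ∃ v : TangentSpace 𝓘(𝕜, E) x, HasVelocity c x v := by
  subst hx
  exact ⟨mfderiv 𝓘(𝕜, 𝕜) 𝓘(𝕜, E) c 0 (1 : 𝕜), hasVelocity_iff.2 ⟨rfl, rfl⟩⟩

theorem HasVelocity.comp {c : 𝕜 → X} {x : X} {v : TangentSpace 𝓘(𝕜, E) x}
    (h : HasVelocity c x v) (hc : SmoothCurve (E := E) 𝕜 c) {f : X → Y}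
    (hf : MDifferentiableAt 𝓘(𝕜, E) 𝓘(𝕜, E') f x) :
    HasVelocity (fun ε => f (c ε)) (f x) (mfderiv 𝓘(𝕜, E) 𝓘(𝕜, E') f x v) := by
  obtain ⟨rfl, h⟩ := hasVelocity_iff.1 h
  rw [hasVelocity_iff]
  refine ⟨rfl, ?_⟩
  have := mfderiv_comp (0 : 𝕜) hf hc.mdifferentiableAt
  change (show E' from mfderiv 𝓘(𝕜, 𝕜) 𝓘(𝕜, E') (f ∘ c) 0 (1 : 𝕜)) = _
  rw [this]
  change (show E' from mfderiv 𝓘(𝕜, E) 𝓘(𝕜, E') f (c 0)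
    (mfderiv 𝓘(𝕜, 𝕜) 𝓘(𝕜, E) c 0 (1 : 𝕜))) = _
  exact congrArg (mfderiv 𝓘(𝕜, E) 𝓘(𝕜, E') f (c 0)) h

theorem HasVelocity.hasDerivAt_comp {c : 𝕜 → X} {x : X} {v : TangentSpace 𝓘(𝕜, E) x}
    (h : HasVelocity c x v) (hc : SmoothCurve (E := E) 𝕜 c) {f : X → V}
    (hf : MDifferentiableAt 𝓘(𝕜, E) 𝓘(𝕜, V) f x) :
    HasDerivAt (fun ε => f (c ε)) (show V from mfderiv 𝓘(𝕜, E) 𝓘(𝕜, V) f x v) 0 := by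
  obtain ⟨rfl, h'⟩ := hasVelocity_iff.1 h
  have h1 := (hasVelocity_iff.1 (h.comp hc hf)).2
  have h2 : MDifferentiableAt 𝓘(𝕜, 𝕜) 𝓘(𝕜, V) (fun ε => f (c ε)) 0 :=
    MDifferentiableAt.comp (0 : 𝕜) hf hc.mdifferentiableAt
  have h3 := h2.differentiableAt.hasFDerivAt.hasDerivAt
  rw [← h1]
  rw [mfderiv_eq_fderiv]
  exact h3

/-- Surjectivity of differentials is proved below by exhibiting curves; this converts such a curve
into a preimage. -/
theorem mem_range_mfderiv {c : 𝕜 → X} {x : X} (hx : c 0 = x) (hc : SmoothCurve (E := E) 𝕜 c)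
    {h : X → V} (hh : MDifferentiableAt 𝓘(𝕜, E) 𝓘(𝕜, V) h x) {t : V}
    (ht : HasDerivAt (fun ε => h (c ε)) t 0) :
    ∃ v, mfderiv 𝓘(𝕜, E) 𝓘(𝕜, V) h x v = t := by
  obtain ⟨v, hv⟩ := SmoothCurve.hasVelocity (E := E) hx
  exact ⟨v, (hv.hasDerivAt_comp hc hh).unique ht⟩

end Velocity

/-! ### Submanifolds, slice charts and tangent vectors -/

section Slices

variable {𝕜 : Type*} [RCLike 𝕜] {E V X E' Y : Type*} [NormedAddCommGroup E] [NormedSpace 𝕜 E]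
  [NormedAddCommGroup V] [NormedSpace 𝕜 V] [TopologicalSpace X] [ChartedSpace E X]
  [NormedAddCommGroup E'] [NormedSpace 𝕜 E'] [TopologicalSpace Y] [ChartedSpace E' Y]

/-- The chart `e` straightens `A` around `x` to the linear subspace `F`. -/
structure IsSliceChart (A : Set X) (x : X) (e : OpenPartialHomeomorph X E) (F : Submodule 𝕜 E) :
    Prop where
  mem_maximalAtlas : e ∈ IsManifold.maximalAtlas 𝓘(𝕜, E) ∞ X
  mem_source : x ∈ e.source
  mem_iff : ∀ y ∈ e.source, (y ∈ A ↔ e y ∈ F)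

theorem Submodule.exists_continuousLinearEquiv_mem_iff [FiniteDimensional 𝕜 E]
    {F F' : Submodule 𝕜 E} (h : Module.finrank 𝕜 F = Module.finrank 𝕜 F') :
    ∃ g : E ≃L[𝕜] E, ∀ u, u ∈ F ↔ g u ∈ F' := by
  obtain ⟨C, hC⟩ := Submodule.exists_isCompl F
  obtain ⟨C', hC'⟩ := Submodule.exists_isCompl F'
  have h1 := Submodule.finrank_add_eq_of_isCompl hC
  have h2 := Submodule.finrank_add_eq_of_isCompl hC'
  let a := LinearEquiv.ofFinrankEq F F' h
  let b := LinearEquiv.ofFinrankEq (R := 𝕜) C C' (by omega)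
  let g := (Submodule.prodEquivOfIsCompl F C hC).symm ≪≫ₗ (a.prodCongr b) ≪≫ₗ
    Submodule.prodEquivOfIsCompl F' C' hC'
  refine ⟨g.toContinuousLinearEquiv, fun u => ?_⟩
  obtain ⟨⟨f, k⟩, rfl⟩ := (Submodule.prodEquivOfIsCompl F C hC).surjective u
  have h3 : ∀ (F C : Submodule 𝕜 E) (hC : IsCompl F C) (w : F × C),
      Submodule.prodEquivOfIsCompl F C hC w ∈ F ↔ w.2 = 0 := by
    intro F C hC w
    rw [← Submodule.prodEquivOfIsCompl_symm_apply_snd_eq_zero F C hC, LinearEquiv.symm_apply_apply]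
  simp [g, h3, -Submodule.coe_prodEquivOfIsCompl']

/-- A finite dimensional subspace is the kernel of a projection. -/
theorem Submodule.exists_surjective_mem_iff [FiniteDimensional 𝕜 E] (F : Submodule 𝕜 E) :
    ∃ (C : Submodule 𝕜 E) (p : E →L[𝕜] C), Function.Surjective p ∧ ∀ u, p u = 0 ↔ u ∈ F := by
  obtain ⟨C, hC⟩ := Submodule.exists_isCompl F
  exact ⟨C, LinearMap.toContinuousLinearMap (C.projectionOnto F hC.symm),
    Submodule.projectionOnto_surjective hC.symm,
    fun u => Submodule.projectionOnto_apply_eq_zero_iff hC.symm⟩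

/-- The definition asks for one subspace common to all charts. Subspaces of equal dimension differ
by a linear automorphism of `E`, with which the charts can be composed. -/
theorem isEmbeddedSubmanifold_of_finrank [FiniteDimensional 𝕜 E] [IsManifold 𝓘(𝕜, E) ∞ X]
    {A : Set X} (n : ℕ)
    (h : ∀ x ∈ A, ∃ e : OpenPartialHomeomorph X E, ∃ F : Submodule 𝕜 E,
      Module.finrank 𝕜 F = n ∧ IsSliceChart A x e F) :
    IsEmbeddedSubmanifold (E := E) 𝕜 A := by
  rcases A.eq_empty_or_nonempty with rfl | ⟨x₀, hx₀⟩
  · exact ⟨⊥, by simp⟩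
  obtain ⟨-, F₀, hF₀, -⟩ := h x₀ hx₀
  refine ⟨F₀, fun x hx => ?_⟩
  obtain ⟨e, F, hF, he⟩ := h x hx
  obtain ⟨g, hg⟩ := Submodule.exists_continuousLinearEquiv_mem_iff (hF.trans hF₀.symm)
  refine ⟨e.transHomeomorph g.toHomeomorph, ?_, he.mem_source, fun y hy => ?_⟩
  · apply OpenPartialHomeomorph.mem_maximalAtlas_of_contMDiffOn
    · exact g.contDiff.contMDiff.comp_contMDiffOn
        (contMDiffOn_of_mem_maximalAtlas he.mem_maximalAtlas)
    · exact (contMDiffOn_symm_of_mem_maximalAtlas he.mem_maximalAtlas).comp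
        g.symm.contDiff.contMDiff.contMDiffOn (fun y hy => hy)
  · rw [he.mem_iff y hy, hg]
    rfl

theorem IsEmbeddedSubmanifold.exists_isSliceChart {A : Set X}
    (hA : IsEmbeddedSubmanifold (E := E) 𝕜 A) : ∃ F : Submodule 𝕜 E, ∀ x ∈ A,
      ∃ e : OpenPartialHomeomorph X E, IsSliceChart A x e F := by
  obtain ⟨F, hF⟩ := hA
  refine ⟨F, fun x hx => ?_⟩
  obtain ⟨e, h1, h2, h3⟩ := hF x hx
  exact ⟨e, h1, h2, h3⟩

/-- The preimage of a linear subspace under a submersion admits slice charts. -/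
theorem exists_isSliceChart_of_submersion [FiniteDimensional 𝕜 E] [FiniteDimensional 𝕜 V]
    [IsManifold 𝓘(𝕜, E) ∞ X] {h : X → V} {U : Set X} (hU : IsOpen U) {x : X} (hx : x ∈ U)
    (hh : ContMDiffOn 𝓘(𝕜, E) 𝓘(𝕜, V) ∞ h U)
    (hs : Function.Surjective (mfderiv 𝓘(𝕜, E) 𝓘(𝕜, V) h x)) {A : Set X} {W : Submodule 𝕜 V}
    (hA : ∀ y ∈ U, (y ∈ A ↔ h y ∈ W)) :
    ∃ e : OpenPartialHomeomorph X E, ∃ F : Submodule 𝕜 E,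
      Module.finrank 𝕜 F = Module.finrank 𝕜 E + Module.finrank 𝕜 W - Module.finrank 𝕜 V ∧
      IsSliceChart A x e F := by
  obtain ⟨e, he, hxe, heU, π, hπ, hπe⟩ := exists_chart_eq_linear hU hx hh hs
  refine ⟨e, W.comap (π : E →ₗ[𝕜] V), ?_, he, hxe, fun y hy => ?_⟩
  · have h1 := LinearMap.finrank_range_add_finrank_ker (W.mkQ ∘ₗ (π : E →ₗ[𝕜] V))
    have h2 : LinearMap.range (W.mkQ ∘ₗ (π : E →ₗ[𝕜] V)) = ⊤ :=
      LinearMap.range_eq_top.2 (W.mkQ_surjective.comp hπ)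
    have h3 : LinearMap.ker (W.mkQ ∘ₗ (π : E →ₗ[𝕜] V)) = W.comap (π : E →ₗ[𝕜] V) := by
      rw [LinearMap.ker_comp, Submodule.ker_mkQ]
    rw [h2, h3, finrank_top] at h1
    have h4 := Submodule.finrank_quotient_add_finrank W
    omega
  · rw [hA y (heU hy), ← hπe y hy]
    rfl

/-- A smooth map on an embedded submanifold extends smoothly to neighbourhoods of its points. -/
theorem SmoothOnSubset.exists_contMDiffOn [FiniteDimensional 𝕜 E] {A : Set X}
    (hA : IsEmbeddedSubmanifold (E := E) 𝕜 A) {f : A → Y}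
    (hf : SmoothOnSubset 𝓘(𝕜, E) 𝓘(𝕜, E') A f) (x : A) :
    ∃ (g : X → Y) (U : Set X), IsOpen U ∧ (x : X) ∈ U ∧ ContMDiffOn 𝓘(𝕜, E) 𝓘(𝕜, E') ∞ g U ∧
      ∀ y : A, (y : X) ∈ U → g y = f y := by
  classical
  obtain ⟨F, hF⟩ := hA.exists_isSliceChart
  obtain ⟨e, he⟩ := hF x x.2
  obtain ⟨F', hF'⟩ := Submodule.exists_isCompl F
  let P : E →L[𝕜] E := LinearMap.toContinuousLinearMap (F.projection F' hF')
  have hP : ∀ u, P u ∈ F := fun u => Submodule.projection_apply_mem hF' u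
  have hP' : ∀ u ∈ F, P u = u := fun u hu => Submodule.projection_apply_of_mem_left hF' hu
  -- A local retraction onto `A`: project the slice coordinates to `F`. The extension is `f ∘ ρ`;
  -- its default value off `A` is never met on `U`.
  let ρ : X → X := fun y => e.symm (P (e y))
  let U : Set X := e.source ∩ e ⁻¹' (P ⁻¹' e.target)
  have hU : IsOpen U := e.isOpen_inter_preimage (e.open_target.preimage P.continuous)
  have hρA : ∀ y ∈ U, ρ y ∈ A := fun y hy => by
    rw [he.mem_iff _ (e.map_target hy.2), e.right_inv hy.2]
    exact hP _
  have hρ : ContMDiffOn 𝓘(𝕜, E) 𝓘(𝕜, E) ∞ ρ U :=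
    (contMDiffOn_symm_of_mem_maximalAtlas he.mem_maximalAtlas).comp
      (P.contMDiff.comp_contMDiffOn ((contMDiffOn_of_mem_maximalAtlas he.mem_maximalAtlas).mono
        fun y hy => hy.1)) fun y hy => hy.2
  have hρid : ∀ y ∈ A, y ∈ e.source → ρ y = y := fun y hy hye => by
    simp only [ρ]
    rw [hP' _ ((he.mem_iff y hye).1 hy), e.left_inv hye]
  refine ⟨fun y => if h : ρ y ∈ A then f ⟨ρ y, h⟩ else f x, U, hU, ?_, ?_, ?_⟩
  · refine ⟨he.mem_source, ?_⟩
    rw [Set.mem_preimage, Set.mem_preimage, hP' _ ((he.mem_iff x he.mem_source).1 x.2)]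
    exact e.map_source he.mem_source
  · intro y hy
    refine (hf.contMDiffAt_comp (hρ.contMDiffAt (hU.mem_nhds hy)) ?_).contMDiffWithinAt
    filter_upwards [hU.mem_nhds hy] with z hz
    exact ⟨hρA z hz, by rw [dif_pos (hρA z hz)]⟩
  · intro y hy
    have h1 := hρid y y.2 hy.1
    simp [h1]

/-- For a curve in `A`, the coordinates transverse to `F` vanish identically near `0`, hence so does
their derivative. -/
theorem IsSliceChart.hasDerivAt_mem [FiniteDimensional 𝕜 E] [IsManifold 𝓘(𝕜, E) ∞ X]
    {A : Set X} {x : X} {e : OpenPartialHomeomorph X E} {F : Submodule 𝕜 E}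
    (he : IsSliceChart A x e F) {v : TangentSpace 𝓘(𝕜, E) x} (hv : v ∈ tangentVectors (E := E) 𝕜 A x) :
    (show E from mfderiv 𝓘(𝕜, E) 𝓘(𝕜, E) e x v) ∈ F := by
  obtain ⟨C, p, -, hp⟩ := F.exists_surjective_mem_iff
  obtain ⟨c, hc, hcA, hcv⟩ := hv
  have hex := (contMDiffAt_of_mem_maximalAtlas he.mem_maximalAtlas he.mem_source).mdifferentiableAt
    (show (∞ : WithTop ℕ∞) ≠ 0 by simp)
  have h1 := (p.hasFDerivAt).comp_hasDerivAt (0 : 𝕜) (hcv.hasDerivAt_comp hc hex)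
  rw [← hp]
  refine h1.unique ((hasDerivAt_const (0 : 𝕜) (0 : C)).congr_of_eventuallyEq ?_)
  have h2 : ∀ᶠ ε in 𝓝 (0 : 𝕜), c ε ∈ e.source :=
    ContMDiffAt.continuousAt hc |>.eventually
      (e.open_source.mem_nhds (by rw [hcv.base]; exact he.mem_source))
  filter_upwards [h2, hcA] with ε h3 h4
  exact (hp _).2 ((he.mem_iff _ h3).1 h4)

theorem exists_curve_of_mem_maximalAtlas [IsManifold 𝓘(𝕜, E) ∞ X] {e : OpenPartialHomeomorph X E}
    (he : e ∈ IsManifold.maximalAtlas 𝓘(𝕜, E) ∞ X) {x : X} (hx : x ∈ e.source) (w : E) :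
    ∃ c : 𝕜 → X, SmoothCurve (E := E) 𝕜 c ∧ c 0 = x ∧
      ∀ᶠ ε in 𝓝 (0 : 𝕜), c ε ∈ e.source ∧ e (c ε) = e x + ε • w := by
  have h0 : e x + (0 : 𝕜) • w = e x := by simp
  have hl : ContDiff 𝕜 ∞ fun ε : 𝕜 => e x + ε • w :=
    contDiff_const.add (contDiff_id.smul contDiff_const)
  refine ⟨fun ε => e.symm (e x + ε • w), ?_, by simp [e.left_inv hx], ?_⟩
  · refine ContMDiffAt.comp (0 : 𝕜) ?_ hl.contMDiff.contMDiffAt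
    rw [h0]
    exact contMDiffAt_symm_of_mem_maximalAtlas he (e.map_source hx)
  · have : ∀ᶠ ε in 𝓝 (0 : 𝕜), e x + ε • w ∈ e.target :=
      hl.continuous.continuousAt.eventually
        (e.open_target.mem_nhds (by simpa using e.map_source hx))
    filter_upwards [this] with ε hε
    exact ⟨e.map_target hε, e.right_inv hε⟩

theorem hasDerivAt_add_smul (a w : E) : HasDerivAt (fun ε : 𝕜 => a + ε • w) w 0 := by
  simpa using ((hasDerivAt_id (0 : 𝕜)).smul_const w).const_add a

theorem bijective_mfderiv_of_mem_maximalAtlas [IsManifold 𝓘(𝕜, E) ∞ X]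
    {e : OpenPartialHomeomorph X E} (he : e ∈ IsManifold.maximalAtlas 𝓘(𝕜, E) ∞ X) {x : X}
    (hx : x ∈ e.source) : Function.Bijective (mfderiv 𝓘(𝕜, E) 𝓘(𝕜, E) e x) := by
  have h : e.MDifferentiable 𝓘(𝕜, E) 𝓘(𝕜, E) :=
    ⟨(contMDiffOn_of_mem_maximalAtlas he).mdifferentiableOn (by simp),
      (contMDiffOn_symm_of_mem_maximalAtlas he).mdifferentiableOn (by simp)⟩
  exact h.mfderiv_bijective hx

/-- The coordinate line in direction `v` stays in `F`, hence in `A`; its velocity is `v` because the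
differential of a chart is injective. -/
theorem IsSliceChart.mem_tangentVectors [FiniteDimensional 𝕜 E] [IsManifold 𝓘(𝕜, E) ∞ X]
    {A : Set X} {x : X} {e : OpenPartialHomeomorph X E} {F : Submodule 𝕜 E}
    (he : IsSliceChart A x e F) (hx : x ∈ A) {v : TangentSpace 𝓘(𝕜, E) x}
    (hv : (show E from mfderiv 𝓘(𝕜, E) 𝓘(𝕜, E) e x v) ∈ F) :
    v ∈ tangentVectors (E := E) 𝕜 A x := by
  obtain ⟨c, hc, hcx, hce⟩ := exists_curve_of_mem_maximalAtlas he.mem_maximalAtlas he.mem_source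
    (show E from mfderiv 𝓘(𝕜, E) 𝓘(𝕜, E) e x v)
  obtain ⟨w, hw⟩ := SmoothCurve.hasVelocity (E := E) hcx
  refine ⟨c, hc, ?_, ?_⟩
  · filter_upwards [hce] with ε hε
    rw [he.mem_iff _ hε.1, hε.2]
    exact F.add_mem ((he.mem_iff x he.mem_source).1 hx) (F.smul_mem ε hv)
  · have hex := (contMDiffAt_of_mem_maximalAtlas he.mem_maximalAtlas
      he.mem_source).mdifferentiableAt (show (∞ : WithTop ℕ∞) ≠ 0 by simp)
    have h1 := hw.hasDerivAt_comp hc hex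
    have h2 := (hasDerivAt_add_smul (𝕜 := 𝕜) (e x)
      (show E from mfderiv 𝓘(𝕜, E) 𝓘(𝕜, E) e x v)).congr_of_eventuallyEq
        (hce.mono fun ε hε => hε.2)
    have h3 : w = v :=
      (bijective_mfderiv_of_mem_maximalAtlas he.mem_maximalAtlas he.mem_source).1 (h1.unique h2)
    rwa [← h3]

/-- Curves cannot be added on a manifold, but a slice chart identifies their velocities with a
linear subspace. -/
theorem IsEmbeddedSubmanifold.add_mem_tangentVectors [FiniteDimensional 𝕜 E]
    [IsManifold 𝓘(𝕜, E) ∞ X] {A : Set X} (hA : IsEmbeddedSubmanifold (E := E) 𝕜 A) {x : X}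
    {v w : TangentSpace 𝓘(𝕜, E) x} (hv : v ∈ tangentVectors (E := E) 𝕜 A x)
    (hw : w ∈ tangentVectors (E := E) 𝕜 A x) : v + w ∈ tangentVectors (E := E) 𝕜 A x := by
  have hx : x ∈ A := by
    obtain ⟨c, -, h1, h2⟩ := hv
    rw [← h2.base]
    exact h1.self_of_nhds
  obtain ⟨F, hF⟩ := hA.exists_isSliceChart
  obtain ⟨e, he⟩ := hF x hx
  refine he.mem_tangentVectors hx ?_
  rw [map_add]
  exact F.add_mem (he.hasDerivAt_mem hv) (he.hasDerivAt_mem hw)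

/-- A submanifold `A` is locally closed, so it contains near its points every set `B` in which
`B ∩ A` is dense. -/
theorem IsEmbeddedSubmanifold.eventually_mem_of_mem_closure [FiniteDimensional 𝕜 E] {A B : Set X}
    (hA : IsEmbeddedSubmanifold (E := E) 𝕜 A) (hB : B ⊆ closure (B ∩ A)) {x : X} (hx : x ∈ A) :
    ∀ᶠ y in 𝓝 x, y ∈ B → y ∈ A := by
  obtain ⟨F, hF⟩ := hA.exists_isSliceChart
  obtain ⟨e, he⟩ := hF x hx
  have hcl : IsClosed (F : Set E) := F.closed_of_finiteDimensional
  filter_upwards [e.open_source.mem_nhds he.mem_source] with y hy hyB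
  by_contra hyA
  have h1 : e y ∉ F := fun h => hyA ((he.mem_iff y hy).2 h)
  have h2 : e.source ∩ e ⁻¹' (F : Set E)ᶜ ∈ 𝓝 y :=
    (e.isOpen_inter_preimage hcl.isOpen_compl).mem_nhds ⟨hy, h1⟩
  obtain ⟨z, ⟨hz1, hz2⟩, -, hz3⟩ := mem_closure_iff_nhds.1 (hB hyB) _ h2
  exact hz2 ((he.mem_iff z hz1).1 hz3)

end Slices

/-! ### Manifold structure pulled back along an open embedding -/

section PulledBackCharts

variable {𝕜 : Type*} [RCLike 𝕜] {E Z W : Type*} [NormedAddCommGroup E] [NormedSpace 𝕜 E]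
  [TopologicalSpace Z] [ChartedSpace E Z] [TopologicalSpace W]

/-- The chart at `w` obtained by pulling back a chart along an open embedding. -/
noncomputable def Topology.IsOpenEmbedding.pullbackChart {Φ : W → Z} (h : IsOpenEmbedding Φ)
    (w : W) : OpenPartialHomeomorph W E :=
  haveI : Nonempty W := ⟨w⟩
  (h.toOpenPartialHomeomorph Φ).trans (chartAt E (Φ w))

/-- The charts on `W` pulled back along an open embedding `W → Z`. -/
noncomputable abbrev Topology.IsOpenEmbedding.pullbackChartedSpace {Φ : W → Z}
    (h : IsOpenEmbedding Φ) : ChartedSpace E W where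
  atlas := Set.range h.pullbackChart
  chartAt := h.pullbackChart
  mem_chart_source w := by simp [IsOpenEmbedding.pullbackChart]
  chart_mem_atlas w := ⟨w, rfl⟩

/-- The transition maps are restrictions of those of `Z`. -/
theorem Topology.IsOpenEmbedding.isManifold_pullback [IsManifold 𝓘(𝕜, E) ∞ Z] {Φ : W → Z}
    (h : IsOpenEmbedding Φ) :
    letI := h.pullbackChartedSpace (E := E)
    IsManifold 𝓘(𝕜, E) ∞ W := by
  let := h.pullbackChartedSpace (E := E)
  apply isManifold_of_contDiffOn
  rintro _ _ ⟨w, rfl⟩ ⟨w', rfl⟩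
  have : Nonempty W := ⟨w⟩
  have hc : ContMDiffOn 𝓘(𝕜, E) 𝓘(𝕜, E) ∞ (chartAt E (Φ w') ∘ (chartAt E (Φ w)).symm)
      ((chartAt E (Φ w)).target ∩ (chartAt E (Φ w)).symm ⁻¹' (chartAt E (Φ w')).source) :=
    contMDiffOn_chart.comp (contMDiffOn_chart_symm.mono fun y hy => hy.1) fun y hy => hy.2
  have hc' := contMDiffOn_iff_contDiffOn.1 hc
  have hval : ∀ u, (h.toOpenPartialHomeomorph Φ) u = Φ u := fun u => rfl
  have hr : ∀ u ∈ Set.range Φ, Φ ((h.toOpenPartialHomeomorph Φ).symm u) = u := fun u hu =>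
    (h.toOpenPartialHomeomorph Φ).right_inv (by simpa using hu)
  refine (hc'.mono (s := _) ?_).congr ?_
  · rintro u hu
    simp [IsOpenEmbedding.pullbackChart] at hu
    have := hu.1.2
    obtain ⟨a, ha⟩ := this
    rw [hr _ ⟨a, ha⟩] at hu
    exact ⟨hu.1.1, hu.2⟩
  · rintro u hu
    simp [IsOpenEmbedding.pullbackChart] at hu
    obtain ⟨a, ha⟩ := hu.1.2
    simp [IsOpenEmbedding.pullbackChart]
    rw [hr _ ⟨a, ha⟩]

/-- Both maps have the same expression in charts by construction; only the continuity conditions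
differ, and they agree because `Φ` is inducing. -/
theorem Topology.IsOpenEmbedding.contMDiffAt_pullback_iff {Φ : W → Z} (h : IsOpenEmbedding Φ)
    {E' H' N : Type*} [NormedAddCommGroup E'] [NormedSpace 𝕜 E'] [TopologicalSpace H']
    {I : ModelWithCorners 𝕜 E' H'} [TopologicalSpace N] [ChartedSpace H' N] {k : N → W} {n : N} :
    letI := h.pullbackChartedSpace (E := E)
    ContMDiffAt I 𝓘(𝕜, E) ∞ k n ↔ ContMDiffAt I 𝓘(𝕜, E) ∞ (fun m => Φ (k m)) n := by
  let := h.pullbackChartedSpace (E := E)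
  rw [contMDiffAt_iff_target, contMDiffAt_iff_target (f := fun m => Φ (k m))]
  rw [h.isInducing.continuousAt_iff]
  rfl

end PulledBackCharts

/-! ### The map `translate` and its submersivity -/

namespace LieGroupoid

variable {𝕜 : Type*} [RCLike 𝕜] {EΓ EM EZ Γ M Z : Type*}
  [NormedAddCommGroup EΓ] [NormedSpace 𝕜 EΓ] [NormedAddCommGroup EM] [NormedSpace 𝕜 EM]
  [NormedAddCommGroup EZ] [NormedSpace 𝕜 EZ]
  [TopologicalSpace Γ] [ChartedSpace EΓ Γ] [TopologicalSpace M] [ChartedSpace EM M]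
  [TopologicalSpace Z] [ChartedSpace EZ Z]
  {G : LieGroupoid 𝕜 (EΓ := EΓ) (EM := EM) Γ M}

theorem inv_inv (G : LieGroupoid 𝕜 (EΓ := EΓ) (EM := EM) Γ M) (γ : Γ) : G.inv (G.inv γ) = γ := by
  have h1 : G.mul (G.mul γ (G.inv γ)) (G.inv (G.inv γ)) = G.inv (G.inv γ) := by
    rw [G.mul_inv, ← G.tgt_inv γ, ← G.src_inv (G.inv γ), G.unit_mul]
  rw [← h1, G.mul_assoc _ _ _ (G.src_inv γ).symm (G.src_inv _).symm, G.mul_inv, G.src_inv,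
    G.mul_unit]

theorem exists_src_section (G : LieGroupoid 𝕜 (EΓ := EΓ) (EM := EM) Γ M) (γ : Γ) :
    ∃ τ : M → Γ, ContMDiffAt 𝓘(𝕜, EM) 𝓘(𝕜, EΓ) ∞ τ (G.src γ) ∧ τ (G.src γ) = γ ∧
      ∀ᶠ m in 𝓝 (G.src γ), G.src (τ m) = m := by
  have h := (G.submersion_src.isSubmersionAt γ).isSubmersionAtOfComplement_complement
  set d := h.domChart
  set c := h.codChart
  have hγ : γ ∈ d.source := h.mem_domChart_source
  have hm : G.src γ ∈ c.source := h.mem_codChart_source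
  have hw : ∀ u ∈ d.target, c (G.src (d.symm u)) = (h.equiv u).1 := fun u hu =>
    h.writtenInCharts (by simpa using hu)
  -- In submersion charts the source is the first projection, so a section through `γ` is obtained
  -- by freezing the second coordinate at its value at `γ`.
  let k : EM → EΓ := fun y => h.equiv.symm (y, (h.equiv (d γ)).2)
  have hk : ContDiff 𝕜 ∞ k := h.equiv.symm.contDiff.comp (contDiff_id.prodMk contDiff_const)
  have hkγ : k (c (G.src γ)) = d γ := by
    have := hw (d γ) (d.map_source hγ)
    rw [d.left_inv hγ] at this
    simp [k, this]
  have hkc : ContMDiffAt 𝓘(𝕜, EM) 𝓘(𝕜, EΓ) ∞ (fun m => k (c m)) (G.src γ) :=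
    hk.comp_contMDiffAt (contMDiffAt_of_mem_maximalAtlas h.codChart_mem_maximalAtlas hm)
  refine ⟨fun m => d.symm (k (c m)), ?_, ?_, ?_⟩
  · refine ContMDiffAt.comp (G.src γ) ?_ hkc
    rw [hkγ]
    exact contMDiffAt_symm_of_mem_maximalAtlas h.domChart_mem_maximalAtlas (d.map_source hγ)
  · simp only [hkγ, d.left_inv hγ]
  · have h1 : ∀ᶠ m in 𝓝 (G.src γ), k (c m) ∈ d.target :=
      hkc.continuousAt.eventually
        (d.open_target.mem_nhds (by simpa only [hkγ] using d.map_source hγ))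
    filter_upwards [h1, c.open_source.mem_nhds hm] with m h2 h3
    have h4 := hw _ h2
    have h5 : G.src (d.symm (k (c m))) ∈ c.source :=
      h.source_subset_preimage_source (d.map_target h2)
    exact c.injOn h5 h3 (by rw [h4]; simp [k])

theorem contMDiffAt_mul (G : LieGroupoid 𝕜 (EΓ := EΓ) (EM := EM) Γ M)
    {E N : Type*} [NormedAddCommGroup E] [NormedSpace 𝕜 E] [TopologicalSpace N] [ChartedSpace E N]
    {f g : N → Γ} {n : N} (hf : ContMDiffAt 𝓘(𝕜, E) 𝓘(𝕜, EΓ) ∞ f n)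
    (hg : ContMDiffAt 𝓘(𝕜, E) 𝓘(𝕜, EΓ) ∞ g n)
    (h : ∀ᶠ m in 𝓝 n, G.tgt (f m) = G.src (g m)) :
    ContMDiffAt 𝓘(𝕜, E) 𝓘(𝕜, EΓ) ∞ (fun m => G.mul (f m) (g m)) n :=
  G.smooth_mul.contMDiffAt_comp (hf.prodMk hg) (h.mono fun _ hm => ⟨hm, rfl⟩)

/-- `Γ_L` is the preimage of a slice of `L` under the source, whose differential is onto because
coordinate lines lift through a local section. -/
theorem isEmbeddedSubmanifold_srcIn [FiniteDimensional 𝕜 EΓ] [FiniteDimensional 𝕜 EM]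
    [IsManifold 𝓘(𝕜, EΓ) ∞ Γ] [IsManifold 𝓘(𝕜, EM) ∞ M]
    (G : LieGroupoid 𝕜 (EΓ := EΓ) (EM := EM) Γ M) {L : Set M}
    (hL : IsEmbeddedSubmanifold (E := EM) 𝕜 L) :
    IsEmbeddedSubmanifold (E := EΓ) 𝕜 (G.srcIn L) := by
  obtain ⟨F, hF⟩ := hL.exists_isSliceChart
  refine isEmbeddedSubmanifold_of_finrank
    (Module.finrank 𝕜 EΓ + Module.finrank 𝕜 F - Module.finrank 𝕜 EM) fun γ hγ => ?_
  obtain ⟨e, he⟩ := hF _ hγ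
  have hsm : ContMDiffOn 𝓘(𝕜, EΓ) 𝓘(𝕜, EM) ∞ (fun y => e (G.src y)) (G.src ⁻¹' e.source) :=
    (contMDiffOn_of_mem_maximalAtlas he.mem_maximalAtlas).comp G.smooth_src.contMDiffOn
      fun y hy => hy
  have hO : IsOpen (G.src ⁻¹' e.source) := e.open_source.preimage G.smooth_src.continuous
  have hd := (hsm.contMDiffAt (hO.mem_nhds he.mem_source)).mdifferentiableAt
    (show (∞ : WithTop ℕ∞) ≠ 0 by simp)
  refine exists_isSliceChart_of_submersion hO he.mem_source hsm ?_ (W := F)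
    fun y hy => he.mem_iff _ hy
  intro v
  obtain ⟨τ, hτ, hτγ, hτs⟩ := G.exists_src_section γ
  obtain ⟨c, hc, hc0, hce⟩ :=
    exists_curve_of_mem_maximalAtlas he.mem_maximalAtlas he.mem_source v
  have hcc : Filter.Tendsto c (𝓝 0) (𝓝 (G.src γ)) := by
    rw [← hc0]
    exact ContMDiffAt.continuousAt hc
  refine mem_range_mfderiv (c := fun ε => τ (c ε)) (by rw [hc0, hτγ])
    (ContMDiffAt.comp (0 : 𝕜) (by rwa [hc0]) hc) hd ?_
  refine (hasDerivAt_add_smul (𝕜 := 𝕜) (e (G.src γ)) v).congr_of_eventuallyEq ?_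
  filter_upwards [hce, hcc.eventually hτs] with ε h1 h2
  rw [h2, h1.2]

namespace IsRightModule

variable {φ : Z → M} {act : Z → Γ → Z}

theorem contMDiffAt_act (h : G.IsRightModule (EZ := EZ) φ act)
    {E N : Type*} [NormedAddCommGroup E] [NormedSpace 𝕜 E] [TopologicalSpace N] [ChartedSpace E N]
    {f : N → Z} {g : N → Γ} {n : N} (hf : ContMDiffAt 𝓘(𝕜, E) 𝓘(𝕜, EZ) ∞ f n)
    (hg : ContMDiffAt 𝓘(𝕜, E) 𝓘(𝕜, EΓ) ∞ g n)
    (hfg : ∀ᶠ m in 𝓝 n, φ (f m) = G.src (g m)) :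
    ContMDiffAt 𝓘(𝕜, E) 𝓘(𝕜, EZ) ∞ (fun m => act (f m) (g m)) n :=
  h.smooth_act.contMDiffAt_comp (hf.prodMk hg) (hfg.mono fun _ hm => ⟨hm, rfl⟩)

theorem act_act_inv (h : G.IsRightModule (EZ := EZ) φ act) {z : Z} {γ : Γ}
    (hz : φ z = G.src γ) : act (act z γ) (G.inv γ) = z := by
  rw [← h.act_mul z γ _ hz (G.src_inv γ).symm, G.mul_inv, ← hz, h.act_unit]

end IsRightModule

/-- `ψ : L → Z` is a smooth lift of the inclusion of the submanifold `L` of `M` to the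
`Γ`-module `(Z, φ)`, with image a submanifold `L'` transverse to the `Γ`-orbits. -/
structure IsTransversalLift (G : LieGroupoid 𝕜 (EΓ := EΓ) (EM := EM) Γ M) (φ : Z → M)
    (act : Z → Γ → Z) (L : Set M) (L' : Set Z) (ψ : L → Z) : Prop where
  module : G.IsRightModule (EZ := EZ) φ act
  base_submanifold : IsEmbeddedSubmanifold (E := EM) 𝕜 L
  submanifold : IsEmbeddedSubmanifold (E := EZ) 𝕜 L'
  bijOn : Set.BijOn φ L' L
  lift_mem : ∀ m, ψ m ∈ L'
  map_lift : ∀ m, φ (ψ m) = m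
  smooth_lift : SmoothOnSubset 𝓘(𝕜, EM) 𝓘(𝕜, EZ) L ψ
  transverse : ∀ z ∈ L',
    tangentVectors (E := EZ) 𝕜 L' z + G.orbitTangentVectors φ act z = Set.univ

/-- The map `Γ_L → Z`, `γ ↦ ψ (src γ) · γ`. -/
def translate (G : LieGroupoid 𝕜 (EΓ := EΓ) (EM := EM) Γ M) (act : Z → Γ → Z) {L : Set M}
    (ψ : L → Z) (γ : G.srcIn L) : Z :=
  act (ψ ⟨G.src γ, γ.2⟩) γ

theorem translate_eq {W : Type*} {act : W → Γ → W} {L : Set M} {ψ : L → W} {γ : Γ} (hγ : γ ∈ G.srcIn L)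
    {m : M} (h : G.src γ = m) :
    G.translate act ψ ⟨γ, hγ⟩ = act (ψ ⟨m, h ▸ hγ⟩) γ := by
  subst h
  rfl

theorem mem_returnArrows_iff_translate {W : Type*} {act : W → Γ → W} {L : Set M} {L' : Set W}
    {ψ : L → W} {r : Γ} : r ∈ G.returnArrows act L L' ψ ↔ ∃ h : r ∈ G.srcIn L,
      G.translate act ψ ⟨r, h⟩ ∈ L' := Iff.rfl

namespace IsTransversalLift

variable {φ : Z → M} {act : Z → Γ → Z} {L : Set M} {L' : Set Z} {ψ : L → Z}

theorem lift_eq (h : G.IsTransversalLift (EZ := EZ) φ act L L' ψ) {z : Z} (hz : z ∈ L') {m : L}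
    (hm : φ z = m) : ψ m = z :=
  h.bijOn.injOn (h.lift_mem m) hz (by rw [h.map_lift, hm])

theorem map_translate (h : G.IsTransversalLift (EZ := EZ) φ act L L' ψ) (γ : G.srcIn L) :
    φ (G.translate act ψ γ) = G.tgt γ :=
  h.module.map_act _ _ (h.map_lift _)

theorem translate_mul (h : G.IsTransversalLift (EZ := EZ) φ act L L' ψ) {γ γ' : Γ}
    (hγ : γ ∈ G.srcIn L) (hγ' : G.tgt γ = G.src γ') (hm : G.mul γ γ' ∈ G.srcIn L) :
    G.translate act ψ ⟨G.mul γ γ', hm⟩ = act (G.translate act ψ ⟨γ, hγ⟩) γ' := by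
  rw [translate_eq hm (G.src_mul γ γ' hγ')]
  exact h.module.act_mul _ γ γ' (h.map_lift _) hγ'

theorem translate_unit (h : G.IsTransversalLift (EZ := EZ) φ act L L' ψ) {m : M} (hm : m ∈ L)
    (hu : G.unit m ∈ G.srcIn L) : G.translate act ψ ⟨G.unit m, hu⟩ = ψ ⟨m, hm⟩ := by
  rw [translate_eq hu (G.src_unit m)]
  have := h.module.act_unit (ψ ⟨m, hm⟩)
  rwa [h.map_lift] at this

/-- The only point of `L'` over `t(r)` is `ψ(t r)`, so membership becomes an equation in `Z`; this
is what closedness and the subgroupoid laws use. -/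
theorem mem_returnArrows_iff (h : G.IsTransversalLift (EZ := EZ) φ act L L' ψ) {r : Γ} :
    r ∈ G.returnArrows act L L' ψ ↔ ∃ (h₁ : r ∈ G.srcIn L) (h₂ : G.tgt r ∈ L),
      G.translate act ψ ⟨r, h₁⟩ = ψ ⟨G.tgt r, h₂⟩ := by
  rw [mem_returnArrows_iff_translate]
  constructor
  · rintro ⟨h₁, h₂⟩
    have h₃ := h.map_translate ⟨r, h₁⟩
    exact ⟨h₁, h₃ ▸ h.bijOn.mapsTo h₂, (h.lift_eq h₂ h₃).symm⟩
  · rintro ⟨h₁, h₂, h₃⟩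
    exact ⟨h₁, h₃ ▸ h.lift_mem _⟩

theorem smoothOnSubset_translate (h : G.IsTransversalLift (EZ := EZ) φ act L L' ψ) :
    SmoothOnSubset 𝓘(𝕜, EΓ) 𝓘(𝕜, EZ) (G.srcIn L) (G.translate act ψ) := by
  intro γ
  have hγ : G.src γ ∈ L := γ.2
  obtain ⟨g, hg, hgψ⟩ := h.smooth_lift ⟨G.src γ, hγ⟩
  obtain ⟨k, hk, hka⟩ := h.module.smooth_act ⟨(ψ ⟨G.src γ, hγ⟩, γ), h.map_lift _⟩
  have hgs : ContMDiffAt 𝓘(𝕜, EΓ) 𝓘(𝕜, EZ) ∞ (fun y => g (G.src y)) (γ : Γ) :=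
    ContMDiffAt.comp (γ : Γ) hg G.smooth_src.contMDiffAt
  have hp : ContMDiffAt 𝓘(𝕜, EΓ) (𝓘(𝕜, EZ).prod 𝓘(𝕜, EΓ)) ∞ (fun y => (g (G.src y), y)) (γ : Γ) :=
    hgs.prodMk contMDiffAt_id
  have h0 : g (G.src γ) = ψ ⟨G.src γ, hγ⟩ := hgψ.self_of_nhds
  rw [nhds_subtype_eq_comap, Filter.eventually_comap] at hgψ hka
  refine ⟨fun y => k (g (G.src y), y), ContMDiffAt.comp (γ : Γ) (by rwa [h0]) hp, ?_⟩
  have h1 := G.smooth_src.continuous.continuousAt.eventually hgψ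
  have h2 := hp.continuousAt.eventually (by simpa only [h0] using hka)
  filter_upwards [continuous_subtype_val.continuousAt.eventually (h1.and h2)] with y ⟨h3, h4⟩
  have h5 := h3 ⟨G.src y, y.2⟩ rfl
  rw [h4 ⟨(g (G.src y), y), by rw [Set.mem_ofPred_eq, h5]; exact h.map_lift _⟩ rfl]
  simp only [h5]
  rfl

/-- Differentials are taken on open subsets of `Γ`, so `translate`, defined only on `Γ_L`, must be
extended first. -/
theorem exists_translate_extension [FiniteDimensional 𝕜 EΓ] [FiniteDimensional 𝕜 EM]
    [IsManifold 𝓘(𝕜, EΓ) ∞ Γ] [IsManifold 𝓘(𝕜, EM) ∞ M]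
    (h : G.IsTransversalLift (EZ := EZ) φ act L L' ψ) (γ : G.srcIn L) :
    ∃ (A : Γ → Z) (U : Set Γ), IsOpen U ∧ (γ : Γ) ∈ U ∧
      ContMDiffOn 𝓘(𝕜, EΓ) 𝓘(𝕜, EZ) ∞ A U ∧
      ∀ y : G.srcIn L, (y : Γ) ∈ U → A y = G.translate act ψ y :=
  h.smoothOnSubset_translate.exists_contMDiffOn (G.isEmbeddedSubmanifold_srcIn h.base_submanifold) γ

/-- Tangent vectors to the orbit through `ψ (src γ) · γ` come from curves `γ · c` in the source
fibre. -/
theorem exists_curve_of_mem_orbitTangentVectors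
    (h : G.IsTransversalLift (EZ := EZ) φ act L L' ψ) (γ : G.srcIn L)
    {w : TangentSpace 𝓘(𝕜, EZ) (G.translate act ψ γ)}
    (hw : w ∈ G.orbitTangentVectors φ act (G.translate act ψ γ)) :
    ∃ c : 𝕜 → Γ, SmoothCurve (E := EΓ) 𝕜 c ∧ c 0 = γ ∧
      ∃ k : 𝕜 → Z, SmoothCurve (E := EZ) 𝕜 k ∧ HasVelocity k (G.translate act ψ γ) w ∧
      ∀ᶠ ε in 𝓝 (0 : 𝕜), G.src (c ε) = G.src γ ∧
        ∃ hc : c ε ∈ G.srcIn L, G.translate act ψ ⟨c ε, hc⟩ = k ε := by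
  obtain ⟨c, hc0, hc, hcs, hcv⟩ := hw
  have ht := h.map_translate γ
  rw [ht] at hc0 hcs
  refine ⟨fun ε => G.mul γ (c ε), ?_, by simp only [hc0, G.mul_unit],
    fun ε => act (G.translate act ψ γ) (c ε), ?_, hcv, ?_⟩
  · exact G.contMDiffAt_mul contMDiffAt_const hc (hcs.mono fun ε hε => hε.symm)
  · exact h.module.contMDiffAt_act contMDiffAt_const hc (hcs.mono fun ε hε => by rw [hε, ht])
  · filter_upwards [hcs] with ε hε
    have hs := G.src_mul (γ : Γ) (c ε) hε.symm
    exact ⟨hs, show G.src _ ∈ L from hs ▸ γ.2, h.translate_mul γ.2 hε.symm _⟩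

/-- Near an arrow of `returnArrows`, the set `returnArrows` is the preimage of a linear subspace
under a submersion which is compatible with the source map. -/
theorem exists_submersion_of_mem_returnArrows [FiniteDimensional 𝕜 EΓ] [FiniteDimensional 𝕜 EM]
    [FiniteDimensional 𝕜 EZ] [IsManifold 𝓘(𝕜, EΓ) ∞ Γ] [IsManifold 𝓘(𝕜, EM) ∞ M]
    [IsManifold 𝓘(𝕜, EZ) ∞ Z] (h : G.IsTransversalLift (EZ := EZ) φ act L L' ψ) (r : G.srcIn L)
    (hr : G.translate act ψ r ∈ L') {F : Submodule 𝕜 EM} {e : OpenPartialHomeomorph M EM}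
    (he : IsSliceChart L (G.src r) e F) {F' C : Submodule 𝕜 EZ} {e' : OpenPartialHomeomorph Z EZ}
    (he' : IsSliceChart L' (G.translate act ψ r) e' F') {p : EZ →L[𝕜] C}
    (hps : Function.Surjective p) (hp : ∀ u, p u = 0 ↔ u ∈ F') :
    ∃ (f : Γ → EM × C) (U : Set Γ), IsOpen U ∧ (r : Γ) ∈ U ∧
      ContMDiffOn 𝓘(𝕜, EΓ) 𝓘(𝕜, EM × C) ∞ f U ∧
      Function.Surjective (mfderiv 𝓘(𝕜, EΓ) 𝓘(𝕜, EM × C) f (r : Γ)) ∧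
      ∀ y ∈ U, G.src y ∈ e.source ∧ (f y).1 = e (G.src y) ∧
        (y ∈ G.returnArrows act L L' ψ ↔ f y ∈ F.prod (⊥ : Submodule 𝕜 C)) := by
  obtain ⟨A, U, hU, hrU, hA, hAt⟩ := h.exists_translate_extension r
  have hAr : A r = G.translate act ψ r := hAt r hrU
  -- The second component is the part of `A` normal to `L'`. It is meaningful only where `A` agrees
  -- with `translate`, that is on `Γ_L`, which the condition on the first component enforces.
  let f : Γ → EM × C := fun y => (e (G.src y), p (e' (A y)))
  let O : Set Γ := (U ∩ A ⁻¹' e'.source) ∩ G.src ⁻¹' e.source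
  have hO : IsOpen O := (hA.continuousOn.isOpen_inter_preimage hU e'.open_source).inter
    (e.open_source.preimage G.smooth_src.continuous)
  have hrO : (r : Γ) ∈ O :=
    ⟨⟨hrU, by rw [Set.mem_preimage, hAr]; exact he'.mem_source⟩, he.mem_source⟩
  have hf : ContMDiffOn 𝓘(𝕜, EΓ) 𝓘(𝕜, EM × C) ∞ f O :=
    ((contMDiffOn_of_mem_maximalAtlas he.mem_maximalAtlas).comp G.smooth_src.contMDiffOn
      fun y hy => hy.2).prodMk_space
    (p.contMDiff.comp_contMDiffOn ((contMDiffOn_of_mem_maximalAtlas he'.mem_maximalAtlas).comp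
      (hA.mono fun y hy => hy.1.1) fun y hy => hy.1.2))
  have hfr : MDifferentiableAt 𝓘(𝕜, EΓ) 𝓘(𝕜, EM × C) f (r : Γ) :=
    (hf.contMDiffAt (hO.mem_nhds hrO)).mdifferentiableAt (by simp)
  have hd' : MDifferentiableAt 𝓘(𝕜, EZ) 𝓘(𝕜, EZ) e' (G.translate act ψ r) :=
    (contMDiffAt_of_mem_maximalAtlas he'.mem_maximalAtlas he'.mem_source).mdifferentiableAt
      (show (∞ : WithTop ℕ∞) ≠ 0 by simp)
  -- Normal directions are reached with the source fixed: the summand tangent to `L'` is killed by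
  -- `p`, and the orbit summand comes from a curve in the source fibre.
  have hvert : ∀ v₂ : C, ∃ u, mfderiv 𝓘(𝕜, EΓ) 𝓘(𝕜, EM × C) f (r : Γ) u = ((0, v₂) : EM × C) := by
    intro v₂
    obtain ⟨v, rfl⟩ := hps v₂
    obtain ⟨w, hw⟩ := (bijective_mfderiv_of_mem_maximalAtlas he'.mem_maximalAtlas
      he'.mem_source).2 v
    obtain ⟨w₁, hw₁, w₂, hw₂, rfl⟩ : w ∈ tangentVectors (E := EZ) 𝕜 L' (G.translate act ψ r) +
        G.orbitTangentVectors φ act (G.translate act ψ r) := by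
      rw [h.transverse _ hr]; trivial
    obtain ⟨c, hc, hc0, k, hk, hkv, hck⟩ := h.exists_curve_of_mem_orbitTangentVectors r hw₂
    refine mem_range_mfderiv hc0 hc hfr ?_
    have h1 := p.hasFDerivAt.comp_hasDerivAt (0 : 𝕜) (hkv.hasDerivAt_comp hk hd')
    have h2 : p (show EZ from mfderiv 𝓘(𝕜, EZ) 𝓘(𝕜, EZ) e' (G.translate act ψ r) w₂) = p v := by
      have h3 := (hp _).2 (he'.hasDerivAt_mem hw₁)
      rw [← hw, map_add]
      exact (map_add p _ _).trans (by rw [h3, zero_add]) |>.symm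
    rw [h2] at h1
    refine ((hasDerivAt_const (0 : 𝕜) (e (G.src r))).prodMk h1).congr_of_eventuallyEq ?_
    have hcO : ∀ᶠ ε in 𝓝 (0 : 𝕜), c ε ∈ O :=
      (ContMDiffAt.continuousAt hc).eventually (hO.mem_nhds (by rwa [hc0]))
    filter_upwards [hck, hcO] with ε ⟨h4, h5, h6⟩ h7
    simp only [f, h4, Function.comp_apply, ← h6]
    rw [← hAt ⟨c ε, h5⟩ h7.1.1]
  refine ⟨f, O, hO, hrO, hf, ?_, fun y hy => ⟨hy.2, rfl, ?_⟩⟩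
  · rintro ⟨v₁, v₂⟩
    obtain ⟨τ, hτ, hτr, hτs⟩ := G.exists_src_section r
    obtain ⟨c, hc, hc0, hce⟩ :=
      exists_curve_of_mem_maximalAtlas he.mem_maximalAtlas he.mem_source v₁
    have hcc : Filter.Tendsto c (𝓝 0) (𝓝 (G.src r)) := by
      rw [← hc0]
      exact ContMDiffAt.continuousAt hc
    obtain ⟨u, hu⟩ := SmoothCurve.hasVelocity (E := EΓ) (𝕜 := 𝕜) (c := fun ε => τ (c ε)) (x := r)
      (by rw [hc0, hτr])
    have h1 := hu.hasDerivAt_comp (ContMDiffAt.comp (0 : 𝕜) (by rwa [hc0]) hc) hfr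
    set t : EM × C := mfderiv 𝓘(𝕜, EΓ) 𝓘(𝕜, EM × C) f (r : Γ) u with ht
    have h2 : t.1 = v₁ := by
      refine ((ContinuousLinearMap.fst 𝕜 EM C).hasFDerivAt.comp_hasDerivAt (0 : 𝕜) h1).unique
        ((hasDerivAt_add_smul (𝕜 := 𝕜) (e (G.src r)) v₁).congr_of_eventuallyEq ?_)
      filter_upwards [hce, hcc.eventually hτs] with ε h3 h4
      simp [f, h4, h3.2]
    -- A lift through the source section gives the right first component; a source-fixed direction
    -- corrects the second without disturbing it.
    obtain ⟨u', hu'⟩ := hvert (v₂ - t.2)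
    refine ⟨u + u', ?_⟩
    rw [map_add, hu', ← ht]
    exact Prod.ext ((add_zero t.1).trans h2) (add_sub_cancel t.2 v₂)
  · rw [Submodule.mem_prod, ← he.mem_iff _ hy.2, Submodule.mem_bot, hp]
    rw [mem_returnArrows_iff_translate]
    constructor
    · rintro ⟨h1, h2⟩
      have h3 := hAt ⟨y, h1⟩ hy.1.1
      exact ⟨h1, by rw [← he'.mem_iff _ hy.1.2, h3]; exact h2⟩
    · rintro ⟨h1, h2⟩
      have h3 := hAt ⟨y, h1⟩ hy.1.1
      exact ⟨h1, by rwa [← h3, he'.mem_iff _ hy.1.2]⟩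

/-- The map `translate` has local smooth sections at units. -/
theorem exists_translate_section_unit [FiniteDimensional 𝕜 EΓ] [FiniteDimensional 𝕜 EM]
    [FiniteDimensional 𝕜 EZ] [IsManifold 𝓘(𝕜, EΓ) ∞ Γ] [IsManifold 𝓘(𝕜, EM) ∞ M]
    [IsManifold 𝓘(𝕜, EZ) ∞ Z] (h : G.IsTransversalLift (EZ := EZ) φ act L L' ψ) (m : L) :
    ∃ σ : Z → Γ, ContMDiffAt 𝓘(𝕜, EZ) 𝓘(𝕜, EΓ) ∞ σ (ψ m) ∧ σ (ψ m) = G.unit m ∧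
      ∀ᶠ w in 𝓝 (ψ m), ∃ hw : σ w ∈ G.srcIn L, G.translate act ψ ⟨σ w, hw⟩ = w := by
  have hum : G.src (G.unit m) = m := G.src_unit m
  have humL : ∀ n ∈ L, G.unit n ∈ G.srcIn L := fun n hn => by
    show G.src _ ∈ L
    rwa [G.src_unit]
  let r : G.srcIn L := ⟨G.unit m, humL m m.2⟩
  have htr : G.translate act ψ r = ψ m := h.translate_unit m.2 _
  obtain ⟨A, U, hU, hrU, hA, hAt⟩ := h.exists_translate_extension r
  have hAr : A r = ψ m := (hAt r hrU).trans htr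
  obtain ⟨F, hF⟩ := h.base_submanifold.exists_isSliceChart
  obtain ⟨e, he⟩ := hF _ m.2
  obtain ⟨C, p, hps, hp⟩ := F.exists_surjective_mem_iff
  set e' := chartAt EZ (ψ m)
  have he'A : e' ∈ IsManifold.maximalAtlas 𝓘(𝕜, EZ) ∞ Z := IsManifold.chart_mem_maximalAtlas _
  have he's : ψ m ∈ e'.source := mem_chart_source EZ (ψ m)
  -- Here the normal component is that of the source relative to `L`, and all coordinates of `Z` are
  -- kept. A local section evaluated at `(0, e' w)` then lies in `Γ_L` and is sent to `w`.
  let f : Γ → C × EZ := fun y => (p (e (G.src y)), e' (A y))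
  let O : Set Γ := (U ∩ A ⁻¹' e'.source) ∩ G.src ⁻¹' e.source
  have hO : IsOpen O := (hA.continuousOn.isOpen_inter_preimage hU e'.open_source).inter
    (e.open_source.preimage G.smooth_src.continuous)
  have hrO : (r : Γ) ∈ O :=
    ⟨⟨hrU, by rwa [Set.mem_preimage, hAr]⟩, by
      rw [Set.mem_preimage]; show G.src (G.unit m) ∈ _; rw [hum]; exact he.mem_source⟩
  have hf : ContMDiffOn 𝓘(𝕜, EΓ) 𝓘(𝕜, C × EZ) ∞ f O :=
    (p.contMDiff.comp_contMDiffOn ((contMDiffOn_of_mem_maximalAtlas he.mem_maximalAtlas).comp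
      G.smooth_src.contMDiffOn fun y hy => hy.2)).prodMk_space
    ((contMDiffOn_of_mem_maximalAtlas he'A).comp (hA.mono fun y hy => hy.1.1)
      fun y hy => hy.1.2)
  have hfr : MDifferentiableAt 𝓘(𝕜, EΓ) 𝓘(𝕜, C × EZ) f (r : Γ) :=
    (hf.contMDiffAt (hO.mem_nhds hrO)).mdifferentiableAt (by simp)
  have hd' : MDifferentiableAt 𝓘(𝕜, EZ) 𝓘(𝕜, EZ) e' (ψ m) :=
    (contMDiffAt_of_mem_maximalAtlas he'A he's).mdifferentiableAt
      (show (∞ : WithTop ℕ∞) ≠ 0 by simp)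
  have hL0 : ∀ n ∈ L, n ∈ e.source → p (e n) = 0 := fun n hn hne =>
    (hp _).2 ((he.mem_iff n hne).1 hn)
  -- Along a curve in `Γ_L` the source stays in `L`, so the first component of `f` remains zero.
  have hzero : ∀ (c : 𝕜 → Γ) (k : 𝕜 → Z) (w : TangentSpace 𝓘(𝕜, EZ) (ψ m)),
      SmoothCurve (E := EΓ) 𝕜 c → c 0 = r → SmoothCurve (E := EZ) 𝕜 k → HasVelocity k (ψ m) w →
      (∀ᶠ ε in 𝓝 (0 : 𝕜), ∃ hc : c ε ∈ G.srcIn L, G.translate act ψ ⟨c ε, hc⟩ = k ε) →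
      ∃ u, mfderiv 𝓘(𝕜, EΓ) 𝓘(𝕜, C × EZ) f (r : Γ) u =
        ((0, (show EZ from mfderiv 𝓘(𝕜, EZ) 𝓘(𝕜, EZ) e' (ψ m) w)) : C × EZ) := by
    intro c k w hc hc0 hk hkw hck
    refine mem_range_mfderiv hc0 hc hfr ?_
    refine ((hasDerivAt_const (0 : 𝕜) (0 : C)).prodMk
      (hkw.hasDerivAt_comp hk hd')).congr_of_eventuallyEq ?_
    have hcO : ∀ᶠ ε in 𝓝 (0 : 𝕜), c ε ∈ O :=
      (ContMDiffAt.continuousAt hc).eventually (hO.mem_nhds (by rwa [hc0]))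
    filter_upwards [hck, hcO] with ε ⟨h5, h6⟩ h7
    simp only [f, ← h6, hL0 _ h5 h7.2]
    rw [← hAt ⟨c ε, h5⟩ h7.1.1]
  have hvert : ∀ v₂ : EZ, ∃ u,
      mfderiv 𝓘(𝕜, EΓ) 𝓘(𝕜, C × EZ) f (r : Γ) u = ((0, v₂) : C × EZ) := by
    intro v
    obtain ⟨w, hw⟩ := (bijective_mfderiv_of_mem_maximalAtlas he'A he's).2 v
    obtain ⟨w₁, hw₁, w₂, hw₂, rfl⟩ : w ∈ tangentVectors (E := EZ) 𝕜 L' (ψ m) +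
        G.orbitTangentVectors φ act (ψ m) := by
      rw [h.transverse _ (h.lift_mem m)]; trivial
    obtain ⟨u₂, hu₂⟩ : ∃ u, mfderiv 𝓘(𝕜, EΓ) 𝓘(𝕜, C × EZ) f (r : Γ) u =
        ((0, (show EZ from mfderiv 𝓘(𝕜, EZ) 𝓘(𝕜, EZ) e' (ψ m) w₂)) : C × EZ) := by
      have hcurve := h.exists_curve_of_mem_orbitTangentVectors r (w := htr ▸ w₂) (by
        clear * - hw₂ htr
        generalize G.translate act ψ r = z at *
        subst htr
        exact hw₂)
      obtain ⟨c, hc, hc0, k, hk, hkv, hck⟩ := hcurve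
      refine hzero c k w₂ hc hc0 hk ?_ (hck.mono fun ε hε => hε.2)
      clear * - hkv htr
      generalize G.translate act ψ r = z at *
      subst htr
      exact hkv
    obtain ⟨u₁, hu₁⟩ : ∃ u, mfderiv 𝓘(𝕜, EΓ) 𝓘(𝕜, C × EZ) f (r : Γ) u =
        ((0, (show EZ from mfderiv 𝓘(𝕜, EZ) 𝓘(𝕜, EZ) e' (ψ m) w₁)) : C × EZ) := by
      obtain ⟨k, hk, hkL, hkv⟩ := hw₁
      -- Directions tangent to `L'` come from units: the unit over `φ (k ε)` is sent by `translate`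
      -- to `k ε` itself.
      refine hzero (fun ε => G.unit (φ (k ε))) k w₁ ?_ ?_ hk hkv ?_
      · exact ContMDiffAt.comp (0 : 𝕜) G.smooth_unit.contMDiffAt
          (ContMDiffAt.comp (0 : 𝕜) h.module.smooth.contMDiffAt hk)
      · simp only [hkv.base, h.map_lift, r]
      · filter_upwards [hkL] with ε hε
        have h1 := h.bijOn.mapsTo hε
        exact ⟨humL _ h1, (h.translate_unit h1 _).trans (h.lift_eq hε rfl)⟩
    refine ⟨u₁ + u₂, ?_⟩
    rw [map_add, hu₁, hu₂, ← hw, map_add]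
    exact Prod.ext (add_zero (0 : C)) rfl
  have hsurj : Function.Surjective (mfderiv 𝓘(𝕜, EΓ) 𝓘(𝕜, C × EZ) f (r : Γ)) := by
    rintro ⟨v₁, v₂⟩
    obtain ⟨v₁, rfl⟩ := hps v₁
    obtain ⟨τ, hτ, hτr, hτs⟩ := G.exists_src_section r
    have hrm : G.src r = m := hum
    rw [hrm] at hτ hτr hτs
    obtain ⟨c, hc, hc0, hce⟩ :=
      exists_curve_of_mem_maximalAtlas he.mem_maximalAtlas he.mem_source v₁
    have hcc : Filter.Tendsto c (𝓝 0) (𝓝 (m : M)) := by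
      rw [← hc0]
      exact ContMDiffAt.continuousAt hc
    obtain ⟨u, hu⟩ := SmoothCurve.hasVelocity (E := EΓ) (𝕜 := 𝕜) (c := fun ε => τ (c ε)) (x := r)
      (by rw [hc0, hτr])
    have h1 := hu.hasDerivAt_comp (ContMDiffAt.comp (0 : 𝕜) (by rwa [hc0]) hc) hfr
    set t : C × EZ := mfderiv 𝓘(𝕜, EΓ) 𝓘(𝕜, C × EZ) f (r : Γ) u with ht
    have h2 : t.1 = p v₁ := by
      refine ((ContinuousLinearMap.fst 𝕜 C EZ).hasFDerivAt.comp_hasDerivAt (0 : 𝕜) h1).unique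
        ((p.hasFDerivAt.comp_hasDerivAt (0 : 𝕜)
        (hasDerivAt_add_smul (𝕜 := 𝕜) (e m) v₁)).congr_of_eventuallyEq ?_)
      filter_upwards [hce, hcc.eventually hτs] with ε h3 h4
      simp [f, h4, h3.2]
    obtain ⟨u', hu'⟩ := hvert (v₂ - t.2)
    refine ⟨u + u', ?_⟩
    rw [map_add, hu', ← ht]
    exact Prod.ext ((add_zero t.1).trans h2) (add_sub_cancel t.2 v₂)
  obtain ⟨s, hs, hsr, hsf⟩ := exists_local_section hO hrO hf hsurj
  have hfrv : f r = (0, e' (ψ m)) := Prod.ext (by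
    show p (e (G.src (G.unit m))) = 0
    rw [hum]; exact hL0 m m.2 he.mem_source) (by simp only [f, hAr])
  rw [hfrv] at hs hsr hsf
  have hi : ContMDiffAt 𝓘(𝕜, EZ) 𝓘(𝕜, C × EZ) ∞ (fun w => ((0 : C), e' w)) (ψ m) :=
    contMDiffAt_const.prodMk_space (contMDiffAt_of_mem_maximalAtlas he'A he's)
  have hσ : ContMDiffAt 𝓘(𝕜, EZ) 𝓘(𝕜, EΓ) ∞ (fun w => s (0, e' w)) (ψ m) :=
    ContMDiffAt.comp (ψ m) hs hi
  refine ⟨fun w => s (0, e' w), hσ, hsr, ?_⟩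
  have hσO : ∀ᶠ w in 𝓝 (ψ m), s (0, e' w) ∈ O :=
    hσ.continuousAt.eventually (hO.mem_nhds (by simpa only [hsr] using hrO))
  filter_upwards [hσO, hi.continuousAt.eventually hsf, e'.open_source.mem_nhds he's]
    with w h1 h2 h3
  have h4 : s (0, e' w) ∈ G.srcIn L :=
    (he.mem_iff _ h1.2).2 ((hp _).1 (congrArg Prod.fst h2))
  refine ⟨h4, ?_⟩
  rw [← hAt ⟨_, h4⟩ h1.1.1]
  exact e'.injOn h1.1.2 h3 (congrArg Prod.snd h2)

/-- The map `translate` has local smooth sections, that is, it is a submersion. -/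
theorem exists_translate_section [FiniteDimensional 𝕜 EΓ] [FiniteDimensional 𝕜 EM]
    [FiniteDimensional 𝕜 EZ] [IsManifold 𝓘(𝕜, EΓ) ∞ Γ] [IsManifold 𝓘(𝕜, EM) ∞ M]
    [IsManifold 𝓘(𝕜, EZ) ∞ Z] (h : G.IsTransversalLift (EZ := EZ) φ act L L' ψ) (γ : G.srcIn L) :
    ∃ σ : Z → Γ, ContMDiffAt 𝓘(𝕜, EZ) 𝓘(𝕜, EΓ) ∞ σ (G.translate act ψ γ) ∧
      σ (G.translate act ψ γ) = γ ∧ ∀ᶠ w in 𝓝 (G.translate act ψ γ),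
        ∃ hw : σ w ∈ G.srcIn L, G.translate act ψ ⟨σ w, hw⟩ = w := by
  set w₀ := G.translate act ψ γ with hw₀
  -- Reduction to units: acting by `τ(φ w)`, which extends `γ⁻¹`, moves `w` near `ψ(s γ)`, where the
  -- section at a unit applies; multiplying by `τ(φ w)⁻¹` undoes the move.
  obtain ⟨τ, hτ, hτγ, hτs⟩ := G.exists_src_section (G.inv γ)
  obtain ⟨σ, hσ, hσm, hσs⟩ := h.exists_translate_section_unit ⟨G.src γ, γ.2⟩
  have hφ : φ w₀ = G.src (G.inv γ) := by rw [hw₀, h.map_translate, G.src_inv]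
  rw [← hφ] at hτ hτγ hτs
  have hτ' : ContMDiffAt 𝓘(𝕜, EZ) 𝓘(𝕜, EΓ) ∞ (fun w => τ (φ w)) w₀ :=
    ContMDiffAt.comp w₀ hτ h.module.smooth.contMDiffAt
  have hs : ∀ᶠ w in 𝓝 w₀, G.src (τ (φ w)) = φ w :=
    h.module.smooth.continuous.continuousAt.eventually hτs
  have ha : ContMDiffAt 𝓘(𝕜, EZ) 𝓘(𝕜, EZ) ∞ (fun w => act w (τ (φ w))) w₀ :=
    h.module.contMDiffAt_act contMDiffAt_id hτ' (hs.mono fun w hw => hw.symm)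
  have ha₀ : act w₀ (τ (φ w₀)) = ψ ⟨G.src γ, γ.2⟩ := by
    rw [hτγ]
    exact h.module.act_act_inv (h.map_lift _)
  have hb : ContMDiffAt 𝓘(𝕜, EZ) 𝓘(𝕜, EΓ) ∞ (fun w => σ (act w (τ (φ w)))) w₀ :=
    ContMDiffAt.comp w₀ (by rwa [ha₀]) ha
  have hev : ∀ᶠ w in 𝓝 w₀, ∃ hw : σ (act w (τ (φ w))) ∈ G.srcIn L,
      G.translate act ψ ⟨_, hw⟩ = act w (τ (φ w)) :=
    ha.continuousAt.eventually (by simpa only [ha₀] using hσs)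
  have hev' : ∀ᶠ w in 𝓝 w₀, G.tgt (σ (act w (τ (φ w)))) = G.src (G.inv (τ (φ w))) := by
    filter_upwards [hs, hev] with w h1 ⟨h2, h3⟩
    have h4 := h.map_translate ⟨_, h2⟩
    rw [h3, h.module.map_act w _ h1.symm] at h4
    rw [G.src_inv, h4]
  refine ⟨fun w => G.mul (σ (act w (τ (φ w)))) (G.inv (τ (φ w))), ?_, ?_, ?_⟩
  · exact G.contMDiffAt_mul hb (ContMDiffAt.comp w₀ G.smooth_inv.contMDiffAt hτ') hev'
  · show G.mul (σ (act w₀ (τ (φ w₀)))) (G.inv (τ (φ w₀))) = γ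
    rw [ha₀, hσm, hτγ, G.inv_inv, G.unit_mul]
  · filter_upwards [hs, hev, hev'] with w h1 ⟨h2, h3⟩ h4
    have h5 : G.mul (σ (act w (τ (φ w)))) (G.inv (τ (φ w))) ∈ G.srcIn L := by
      show G.src _ ∈ L
      rw [G.src_mul _ _ h4]
      exact h2
    exact ⟨h5, by rw [h.translate_mul h2 h4, h3, h.module.act_act_inv h1.symm]⟩

end IsTransversalLift

end LieGroupoid

/-! ### Submersions detected by lifting curves -/

section Submanifolds

variable {𝕜 : Type*} [RCLike 𝕜] {E X E' Y : Type*} [NormedAddCommGroup E] [NormedSpace 𝕜 E]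
  [TopologicalSpace X] [ChartedSpace E X]
  [NormedAddCommGroup E'] [NormedSpace 𝕜 E'] [TopologicalSpace Y] [ChartedSpace E' Y]

theorem HasVelocity.unique {c : 𝕜 → X} {x : X} {v w : TangentSpace 𝓘(𝕜, E) x}
    (hv : HasVelocity c x v) (hw : HasVelocity c x w) : v = w :=
  eq_of_heq ((Bundle.TotalSpace.mk.injEq _ _ _ _).mp (hv.symm.trans hw)).2

theorem SmoothOnSubset.continuous {A : Set X} {f : A → Y}
    (hf : SmoothOnSubset 𝓘(𝕜, E) 𝓘(𝕜, E') A f) : Continuous f := by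
  rw [continuous_iff_continuousAt]
  intro x
  obtain ⟨g, hg, hgf⟩ := hf x
  exact (ContinuousAt.comp (f := ((↑) : A → X)) hg.continuousAt
    continuous_subtype_val.continuousAt).congr hgf

theorem ContMDiff.smoothOnSubset {f : X → Y} (hf : ContMDiff 𝓘(𝕜, E) 𝓘(𝕜, E') ∞ f) (A : Set X) :
    SmoothOnSubset 𝓘(𝕜, E) 𝓘(𝕜, E') A (fun x => f x) :=
  fun _ => ⟨f, hf.contMDiffAt, Filter.Eventually.of_forall fun _ => rfl⟩

/-- A map along which smooth curves lift is a submersion. -/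
theorem isSubmersionBetween_of_lift {A : Set X} {f : A → Y} {B : Set Y}
    (h : ∀ (x : A) (k : 𝕜 → Y), SmoothCurve (E := E') 𝕜 k → k 0 = f x →
      (∀ᶠ ε in 𝓝 (0 : 𝕜), k ε ∈ B) → ∃ c : 𝕜 → X, SmoothCurve (E := E) 𝕜 c ∧ c 0 = x ∧
        ∀ᶠ ε in 𝓝 (0 : 𝕜), ∃ hc : c ε ∈ A, f ⟨c ε, hc⟩ = k ε) :
    IsSubmersionBetween (E := E) (E' := E') 𝕜 A f B := by
  classical
  rintro x v ⟨k, hk, hkB, hkv⟩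
  obtain ⟨c, hc, hc0, hck⟩ := h x k hk hkv.base hkB
  -- A submersion requires curves with values in `A` at all times; the constant `x` fills in where
  -- the lift has left `A`.
  refine ⟨fun ε => if hε : c ε ∈ A then ⟨c ε, hε⟩ else x, ?_, ?_, hkv.congr ?_⟩
  · simp [hc0]
  · refine ContMDiffAt.congr_of_eventuallyEq hc ?_
    filter_upwards [hck] with ε ⟨h1, _⟩
    simp [h1]
  · filter_upwards [hck] with ε ⟨h1, h2⟩
    simp [h1, h2]

end Submanifolds

/-! ### Open embeddings as diffeomorphisms onto their range -/

section PulledBackCharts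

variable {𝕜 : Type*} [RCLike 𝕜] {E Z W : Type*} [NormedAddCommGroup E] [NormedSpace 𝕜 E]
  [TopologicalSpace Z] [ChartedSpace E Z] [TopologicalSpace W]

theorem Topology.IsOpenEmbedding.contMDiff_pullback {Φ : W → Z} (h : IsOpenEmbedding Φ) :
    letI := h.pullbackChartedSpace (E := E)
    ContMDiff 𝓘(𝕜, E) 𝓘(𝕜, E) ∞ Φ := by
  let := h.pullbackChartedSpace (E := E)
  exact fun w => h.contMDiffAt_pullback_iff.1 contMDiffAt_id

theorem Topology.IsOpenEmbedding.contMDiffAt_invFun_pullback [Nonempty W] {Φ : W → Z}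
    (h : IsOpenEmbedding Φ) {z : Z} (hz : z ∈ Set.range Φ) :
    letI := h.pullbackChartedSpace (E := E)
    ContMDiffAt 𝓘(𝕜, E) 𝓘(𝕜, E) ∞ (Function.invFun Φ) z := by
  let := h.pullbackChartedSpace (E := E)
  refine h.contMDiffAt_pullback_iff.2 (contMDiffAt_id.congr_of_eventuallyEq ?_)
  filter_upwards [h.isOpen_range.mem_nhds hz] with y hy
  exact Function.invFun_eq hy

theorem Topology.IsOpenEmbedding.isDiffeoBetween_pullback {Φ : W → Z} (h : IsOpenEmbedding Φ) :
    letI := h.pullbackChartedSpace (E := E)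
    IsDiffeoBetween (E := E) (E' := E) 𝕜 Φ Set.univ (Set.range Φ) := by
  let := h.pullbackChartedSpace (E := E)
  refine ⟨⟨fun w _ => ⟨w, rfl⟩, h.injective.injOn,
    fun _ ⟨w, hw⟩ => ⟨w, trivial, hw⟩⟩,
    (h.contMDiff_pullback (𝕜 := 𝕜)).smoothOnSubset _, fun b => b.2.choose,
    fun b => ⟨trivial, b.2.choose_spec⟩, fun b => ?_⟩
  have : Nonempty W := ⟨b.2.choose⟩
  refine ⟨Function.invFun Φ, h.contMDiffAt_invFun_pullback b.2, Filter.Eventually.of_forall ?_⟩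
  intro y
  exact h.injective ((Function.invFun_eq y.2).trans y.2.choose_spec.symm)

end PulledBackCharts

namespace LieGroupoid

variable {𝕜 : Type*} [RCLike 𝕜] {EΓ EM EZ Γ M Z : Type*}
  [NormedAddCommGroup EΓ] [NormedSpace 𝕜 EΓ] [NormedAddCommGroup EM] [NormedSpace 𝕜 EM]
  [NormedAddCommGroup EZ] [NormedSpace 𝕜 EZ]
  [TopologicalSpace Γ] [ChartedSpace EΓ Γ] [TopologicalSpace M] [ChartedSpace EM M]
  [TopologicalSpace Z] [ChartedSpace EZ Z]
  {G : LieGroupoid 𝕜 (EΓ := EΓ) (EM := EM) Γ M}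

namespace IsTransversalLift

variable {φ : Z → M} {act : Z → Γ → Z} {L : Set M} {L' : Set Z} {ψ : L → Z}

/-! ### The closed Lie subgroupoid of return arrows -/

section ReturnArrows

theorem unit_mem_returnArrows (h : G.IsTransversalLift (EZ := EZ) φ act L L' ψ) {m : M}
    (hm : m ∈ L) : G.unit m ∈ G.returnArrows act L L' ψ := by
  have hu : G.unit m ∈ G.srcIn L := by
    show G.src _ ∈ L
    rwa [G.src_unit]
  rw [mem_returnArrows_iff_translate]
  exact ⟨hu, by rw [h.translate_unit hm hu]; exact h.lift_mem _⟩

theorem mul_mem_returnArrows (h : G.IsTransversalLift (EZ := EZ) φ act L L' ψ) {r r' : Γ}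
    (hr : r ∈ G.returnArrows act L L' ψ) (hr' : r' ∈ G.returnArrows act L L' ψ)
    (hrr' : G.tgt r = G.src r') : G.mul r r' ∈ G.returnArrows act L L' ψ := by
  obtain ⟨h1, h2, h3⟩ := h.mem_returnArrows_iff.1 hr
  obtain ⟨h1', h2'⟩ := mem_returnArrows_iff_translate.1 hr'
  have hm : G.mul r r' ∈ G.srcIn L := by
    show G.src _ ∈ L
    rw [G.src_mul r r' hrr']
    exact h1
  refine mem_returnArrows_iff_translate.2 ⟨hm, ?_⟩
  rw [h.translate_mul h1 hrr', h3]
  rwa [translate_eq h1' hrr'.symm] at h2'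

/-- Acting by `r⁻¹` on `ψ(t r) = ψ(s r)·r` gives back `ψ(s r) ∈ L'`. -/
theorem inv_mem_returnArrows (h : G.IsTransversalLift (EZ := EZ) φ act L L' ψ) {r : Γ}
    (hr : r ∈ G.returnArrows act L L' ψ) : G.inv r ∈ G.returnArrows act L L' ψ := by
  obtain ⟨h1, h2, h3⟩ := h.mem_returnArrows_iff.1 hr
  have hm : G.inv r ∈ G.srcIn L := by
    show G.src _ ∈ L
    rwa [G.src_inv]
  refine mem_returnArrows_iff_translate.2 ⟨hm, ?_⟩
  rw [translate_eq hm (G.src_inv r), ← h3]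
  have := h.module.act_act_inv (z := ψ ⟨G.src r, h1⟩) (γ := r) (h.map_lift _)
  rw [show G.translate act ψ ⟨r, h1⟩ = act (ψ ⟨G.src r, h1⟩) r from rfl, this]
  exact h.lift_mem _

variable [FiniteDimensional 𝕜 EΓ] [FiniteDimensional 𝕜 EM] [FiniteDimensional 𝕜 EZ]
  [IsManifold 𝓘(𝕜, EΓ) ∞ Γ] [IsManifold 𝓘(𝕜, EM) ∞ M] [IsManifold 𝓘(𝕜, EZ) ∞ Z]

/-- The subspaces `F` and `F'` are chosen once for all points, so the slices of `R` have the same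
dimension everywhere. -/
theorem isEmbeddedSubmanifold_returnArrows (h : G.IsTransversalLift (EZ := EZ) φ act L L' ψ) :
    IsEmbeddedSubmanifold (E := EΓ) 𝕜 (G.returnArrows act L L' ψ) := by
  obtain ⟨F, hF⟩ := h.base_submanifold.exists_isSliceChart
  obtain ⟨F', hF'⟩ := h.submanifold.exists_isSliceChart
  obtain ⟨C, p, hps, hp⟩ := F'.exists_surjective_mem_iff
  refine isEmbeddedSubmanifold_of_finrank (Module.finrank 𝕜 EΓ +
    Module.finrank 𝕜 (F.prod (⊥ : Submodule 𝕜 C)) - Module.finrank 𝕜 (EM × C)) fun r hr => ?_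
  obtain ⟨h1, h2⟩ := mem_returnArrows_iff_translate.1 hr
  obtain ⟨e, he⟩ := hF _ h1
  obtain ⟨e', he'⟩ := hF' _ h2
  obtain ⟨f, U, hU, hrU, hf, hs, hfU⟩ :=
    h.exists_submersion_of_mem_returnArrows ⟨r, h1⟩ h2 he he' hps hp
  exact exists_isSliceChart_of_submersion hU hrU hf hs fun y hy => (hfU y hy).2.2

/-- Smooth curves in `L` lift along the source map of `returnArrows`. -/
theorem exists_lift_src (h : G.IsTransversalLift (EZ := EZ) φ act L L' ψ) {r : Γ}
    (hr : r ∈ G.returnArrows act L L' ψ) {k : 𝕜 → M} (hk : SmoothCurve (E := EM) 𝕜 k)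
    (hk0 : k 0 = G.src r) (hkL : ∀ᶠ ε in 𝓝 (0 : 𝕜), k ε ∈ L) :
    ∃ c : 𝕜 → Γ, SmoothCurve (E := EΓ) 𝕜 c ∧ c 0 = r ∧
      ∀ᶠ ε in 𝓝 (0 : 𝕜), c ε ∈ G.returnArrows act L L' ψ ∧ G.src (c ε) = k ε := by
  obtain ⟨F, hF⟩ := h.base_submanifold.exists_isSliceChart
  obtain ⟨F', hF'⟩ := h.submanifold.exists_isSliceChart
  obtain ⟨C, p, hps, hp⟩ := F'.exists_surjective_mem_iff
  obtain ⟨h1, h2⟩ := mem_returnArrows_iff_translate.1 hr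
  obtain ⟨e, he⟩ := hF _ h1
  obtain ⟨e', he'⟩ := hF' _ h2
  obtain ⟨f, U, hU, hrU, hf, hs, hfU⟩ :=
    h.exists_submersion_of_mem_returnArrows ⟨r, h1⟩ h2 he he' hps hp
  obtain ⟨s, hs, hsr, hsf⟩ := exists_local_section hU hrU hf hs
  have hfr : f r = (e (G.src r), 0) :=
    Prod.ext (hfU r hrU).2.1 ((Submodule.mem_prod.1 ((hfU r hrU).2.2.1 hr)).2)
  -- The lift is a local section of `f` along `(e (k ε), 0)`: the first entry prescribes the source,
  -- and the zero normal component keeps the arrow in `R`.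
  have hi : ContMDiffAt 𝓘(𝕜, 𝕜) 𝓘(𝕜, EM × C) ∞ (fun ε => (e (k ε), (0 : C))) 0 :=
    (ContMDiffAt.comp (0 : 𝕜) (contMDiffAt_of_mem_maximalAtlas he.mem_maximalAtlas
      (by rw [hk0]; exact he.mem_source)) hk).prodMk_space contMDiffAt_const
  have hi0 : (e (k 0), (0 : C)) = f r := by rw [hfr, hk0]
  have hc : ContMDiffAt 𝓘(𝕜, 𝕜) 𝓘(𝕜, EΓ) ∞ (fun ε => s (e (k ε), 0)) 0 :=
    ContMDiffAt.comp (0 : 𝕜) (by rwa [hi0]) hi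
  have hc0 : s (e (k 0), 0) = r := by rw [hi0, hsr]
  refine ⟨fun ε => s (e (k ε), 0), hc, hc0, ?_⟩
  have h3 : ∀ᶠ ε in 𝓝 (0 : 𝕜), s (e (k ε), 0) ∈ U :=
    hc.continuousAt.eventually (hU.mem_nhds (by simpa only [hc0] using hrU))
  have h4 := hi.continuousAt.eventually (by simpa only [hi0] using hsf)
  have h5 : ∀ᶠ ε in 𝓝 (0 : 𝕜), k ε ∈ e.source :=
    (ContMDiffAt.continuousAt hk).eventually
      (e.open_source.mem_nhds (by rw [hk0]; exact he.mem_source))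
  filter_upwards [h3, h4, h5, hkL] with ε h6 h7 h8 h9
  obtain ⟨h10, h11, h12⟩ := hfU _ h6
  rw [h7] at h11 h12
  exact ⟨h12.2 ⟨(he.mem_iff _ h8).1 h9, Submodule.zero_mem _⟩, e.injOn h10 h8 h11.symm⟩

theorem isLieSubgroupoid (h : G.IsTransversalLift (EZ := EZ) φ act L L' ψ) :
    G.IsLieSubgroupoid (G.returnArrows act L L' ψ) L where
  submanifold_arrows := h.isEmbeddedSubmanifold_returnArrows
  submanifold_units := h.base_submanifold
  src_mem r hr := (h.mem_returnArrows_iff.1 hr).1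
  tgt_mem r hr := (h.mem_returnArrows_iff.1 hr).2.1
  unit_mem m hm := h.unit_mem_returnArrows hm
  inv_mem r hr := h.inv_mem_returnArrows hr
  mul_mem r hr r' hr' := h.mul_mem_returnArrows hr hr'
  submersion_src := by
    refine isSubmersionBetween_of_lift fun r k hk hk0 hkL => ?_
    obtain ⟨c, hc, hc0, hck⟩ := h.exists_lift_src r.2 hk hk0 hkL
    exact ⟨c, hc, hc0, hck.mono fun ε hε => ⟨hε.1, hε.2⟩⟩
  submersion_tgt := by
    refine isSubmersionBetween_of_lift fun r k hk hk0 hkL => ?_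
    -- Inversion preserves `R` and exchanges source and target, so the lift is made at `r⁻¹` and
    -- then inverted.
    obtain ⟨c, hc, hc0, hck⟩ := h.exists_lift_src (h.inv_mem_returnArrows r.2) hk
      (by rw [hk0, G.src_inv]) hkL
    refine ⟨fun ε => G.inv (c ε), ContMDiffAt.comp (0 : 𝕜) G.smooth_inv.contMDiffAt hc,
      by simp only [hc0, G.inv_inv], hck.mono fun ε hε => ?_⟩
    exact ⟨h.inv_mem_returnArrows hε.1, by simp only [G.tgt_inv, hε.2]⟩

end ReturnArrows

theorem isClosedSubgroupoid [T2Space Z] (h : G.IsTransversalLift (EZ := EZ) φ act L L' ψ) :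
    G.IsClosedSubgroupoid (G.returnArrows act L L' ψ) L := by
  have h1 : Continuous fun γ : G.between L L => G.translate act ψ ⟨γ, γ.2.1⟩ :=
    h.smoothOnSubset_translate.continuous.comp (by fun_prop)
  have h2 : Continuous fun γ : G.between L L => ψ ⟨G.tgt γ, γ.2.2⟩ :=
    h.smooth_lift.continuous.comp
      ((G.smooth_tgt.continuous.comp continuous_subtype_val).subtype_mk _)
  unfold IsClosedSubgroupoid
  convert isClosed_eq h1 h2 using 1
  ext γ
  exact ⟨fun hγ => (h.mem_returnArrows_iff.1 hγ).2.2,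
    fun hγ => h.mem_returnArrows_iff.2 ⟨γ.2.1, γ.2.2, hγ⟩⟩

/-! ### The quotient `Z(R)` as an open part of `Z` -/

section Quotient

/-- The map `Z(R) → Z` induced by `γ ↦ ψ (src γ) · γ`. -/
def quotientMap (h : G.IsTransversalLift (EZ := EZ) φ act L L' ψ) :
    G.LeftQuotient (G.returnArrows act L L' ψ) L → Z :=
  Quot.lift (G.translate act ψ) (by
    rintro ⟨γ', hγ'⟩ γ ⟨r, hr, hrγ, rfl⟩
    obtain ⟨h1, h2, h3⟩ := h.mem_returnArrows_iff.1 hr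
    rw [h.translate_mul h1 hrγ, h3]
    exact (translate_eq γ.2 hrγ.symm).symm)

theorem map_quotientMap (h : G.IsTransversalLift (EZ := EZ) φ act L L' ψ)
    (w : G.LeftQuotient (G.returnArrows act L L' ψ) L) :
    φ (h.quotientMap w) = G.leftQuotientMap (G.returnArrows act L L' ψ) L w := by
  induction w using Quot.ind with
  | mk γ => exact h.map_translate γ

/-- The arrow `γγ'⁻¹` sends `ψ(s γ)` to `ψ(s γ')`, so it lies in `R`, and `γ` is its product with
`γ'`. -/
theorem quotientMap_injective (h : G.IsTransversalLift (EZ := EZ) φ act L L' ψ) :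
    Function.Injective h.quotientMap := by
  intro w w' hww
  induction w using Quot.ind with
  | mk γ =>
  induction w' using Quot.ind with
  | mk γ' =>
  change G.translate act ψ γ = G.translate act ψ γ' at hww
  have ht : G.tgt (γ : Γ) = G.tgt (γ' : Γ) := by
    rw [← h.map_translate γ, hww, h.map_translate]
  have hc : G.tgt (γ : Γ) = G.src (G.inv (γ' : Γ)) := by rw [ht, G.src_inv]
  have hm : G.mul (γ : Γ) (G.inv γ') ∈ G.srcIn L := by
    show G.src _ ∈ L
    rw [G.src_mul _ _ hc]
    exact γ.2
  refine Quot.sound ⟨G.mul γ (G.inv γ'), ?_, ?_, ?_⟩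
  · refine mem_returnArrows_iff_translate.2 ⟨hm, ?_⟩
    rw [h.translate_mul γ.2 hc]
    change act (G.translate act ψ γ) _ ∈ L'
    rw [hww]
    rw [show act (G.translate act ψ γ') (G.inv γ') = ψ ⟨G.src γ', γ'.2⟩ from
      h.module.act_act_inv (h.map_lift _)]
    exact h.lift_mem _
  · rw [G.tgt_mul _ _ hc, G.tgt_inv]
  · rw [G.mul_assoc _ _ _ hc (G.tgt_inv _), G.inv_mul, ← ht, G.mul_unit]

theorem range_quotientMap (h : G.IsTransversalLift (EZ := EZ) φ act L L' ψ) :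
    Set.range h.quotientMap = G.orbitOf φ act L' := by
  ext w
  constructor
  · rintro ⟨w, rfl⟩
    induction w using Quot.ind with
    | mk γ => exact ⟨ψ ⟨G.src γ, γ.2⟩, h.lift_mem _, γ, h.map_lift _, rfl⟩
  · rintro ⟨z, hz, γ, hγ, rfl⟩
    have hm : γ ∈ G.srcIn L := by
      show G.src γ ∈ L
      rw [← hγ]
      exact h.bijOn.mapsTo hz
    refine ⟨Quot.mk _ ⟨γ, hm⟩, ?_⟩
    show G.translate act ψ ⟨γ, hm⟩ = _
    rw [translate_eq hm rfl, h.lift_eq hz hγ]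

open Classical in
/-- The right action `[γ] · γ' = [γ γ']` of `Γ` on `Z(R)`. -/
noncomputable def quotientAct (h : G.IsTransversalLift (EZ := EZ) φ act L L' ψ)
    (w : G.LeftQuotient (G.returnArrows act L L' ψ) L) (γ : Γ) :
    G.LeftQuotient (G.returnArrows act L L' ψ) L :=
  -- The action is transported from `Z`, which avoids choosing representatives. The default `w`
  -- matters only for pairs where the action is meaningless.
  if hw : ∃ w', h.quotientMap w' = act (h.quotientMap w) γ then hw.choose else w

theorem quotientMap_quotientAct (h : G.IsTransversalLift (EZ := EZ) φ act L L' ψ)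
    {w : G.LeftQuotient (G.returnArrows act L L' ψ) L} {γ : Γ}
    (hw : G.leftQuotientMap (G.returnArrows act L L' ψ) L w = G.src γ) :
    h.quotientMap (h.quotientAct w γ) = act (h.quotientMap w) γ := by
  have hex : ∃ w', h.quotientMap w' = act (h.quotientMap w) γ := by
    induction w using Quot.ind with
    | mk γ' =>
    have hc : G.tgt (γ' : Γ) = G.src γ := hw
    have hm : G.mul (γ' : Γ) γ ∈ G.srcIn L := by
      show G.src _ ∈ L
      rw [G.src_mul _ _ hc]
      exact γ'.2
    exact ⟨Quot.mk _ ⟨_, hm⟩, h.translate_mul γ'.2 hc hm⟩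
  rw [quotientAct, dif_pos hex]
  exact hex.choose_spec

theorem continuous_quotientMap (h : G.IsTransversalLift (EZ := EZ) φ act L L' ψ) :
    Continuous h.quotientMap :=
  continuous_quot_lift _ h.smoothOnSubset_translate.continuous

variable [FiniteDimensional 𝕜 EΓ] [FiniteDimensional 𝕜 EM] [FiniteDimensional 𝕜 EZ]
  [IsManifold 𝓘(𝕜, EΓ) ∞ Γ] [IsManifold 𝓘(𝕜, EM) ∞ M] [IsManifold 𝓘(𝕜, EZ) ∞ Z]

/-- A continuous local section through `γ` shows that the image of a neighbourhood of `γ` is a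
neighbourhood of the image of `γ`. -/
theorem isOpenMap_translate (h : G.IsTransversalLift (EZ := EZ) φ act L L' ψ) :
    IsOpenMap (G.translate act ψ) := by
  rw [isOpenMap_iff_nhds_le]
  intro γ s hs
  rw [Filter.mem_map, nhds_subtype_eq_comap] at hs
  obtain ⟨O, hO, hOs⟩ := hs
  obtain ⟨σ, hσ, hσγ, hσs⟩ := h.exists_translate_section γ
  have h1 : ∀ᶠ w in 𝓝 (G.translate act ψ γ), σ w ∈ O :=
    hσ.continuousAt.eventually (by rwa [hσγ])
  filter_upwards [h1, hσs] with w h2 ⟨h3, h4⟩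
  have h5 : G.translate act ψ ⟨σ w, h3⟩ ∈ s := hOs h2
  rwa [h4] at h5

/-- The image of an open set is the image under `translate` of its preimage in `Γ_L`, so openness
passes to the quotient. -/
theorem isOpenEmbedding_quotientMap (h : G.IsTransversalLift (EZ := EZ) φ act L L' ψ) :
    Topology.IsOpenEmbedding h.quotientMap := by
  refine Topology.IsOpenEmbedding.of_continuous_injective_isOpenMap h.continuous_quotientMap
    h.quotientMap_injective fun U hU => ?_
  have h1 := h.isOpenMap_translate _ (hU.preimage continuous_quot_mk)
  convert h1 using 1
  ext z
  constructor
  · rintro ⟨w, hw, rfl⟩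
    induction w using Quot.ind with
    | mk γ => exact ⟨γ, hw, rfl⟩
  · rintro ⟨γ, hγ, rfl⟩
    exact ⟨Quot.mk _ γ, hγ, rfl⟩

theorem isQuotientModule [T2Space Z] (h : G.IsTransversalLift (EZ := EZ) φ act L L' ψ) :
    letI := h.isOpenEmbedding_quotientMap.pullbackChartedSpace (E := EZ)
    G.IsQuotientModule (EZ := EZ) (G.returnArrows act L L' ψ) L h.quotientAct := by
  have hΦ := h.isOpenEmbedding_quotientMap
  let := hΦ.pullbackChartedSpace (E := EZ)
  refine ⟨hΦ.isManifold_pullback, T2Space.of_injective_continuous hΦ.injective hΦ.continuous,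
    fun γ => ?_, isSubmersionBetween_of_lift fun γ k hk hk0 _ => ?_, fun γ γ' hγ => ?_⟩
  · obtain ⟨g, hg, hgt⟩ := h.smoothOnSubset_translate γ
    have : Nonempty (G.LeftQuotient (G.returnArrows act L L' ψ) L) := ⟨Quot.mk _ γ⟩
    have hr : g γ ∈ Set.range h.quotientMap := ⟨Quot.mk _ γ, hgt.self_of_nhds.symm⟩
    refine ⟨fun y => Function.invFun h.quotientMap (g y),
      ContMDiffAt.comp (γ : Γ) (hΦ.contMDiffAt_invFun_pullback hr) hg, ?_⟩
    filter_upwards [hgt] with y hy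
    rw [hy]
    exact Function.leftInverse_invFun hΦ.injective (Quot.mk _ y)
  · obtain ⟨σ, hσ, hσγ, hσs⟩ := h.exists_translate_section γ
    have h0 : h.quotientMap (k 0) = G.translate act ψ γ := by rw [hk0]; rfl
    have hk' : ContMDiffAt 𝓘(𝕜, 𝕜) 𝓘(𝕜, EZ) ∞ (fun ε => h.quotientMap (k ε)) 0 :=
      hΦ.contMDiffAt_pullback_iff.1 hk
    refine ⟨fun ε => σ (h.quotientMap (k ε)),
      ContMDiffAt.comp (0 : 𝕜) (by rwa [h0]) hk', by simp only [h0, hσγ], ?_⟩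
    filter_upwards [hk'.continuousAt.eventually (by simpa only [h0] using hσs)] with ε ⟨h1, h2⟩
    exact ⟨h1, hΦ.injective h2⟩
  · refine hΦ.injective ?_
    rw [h.quotientMap_quotientAct (w := G.toLeftQuotient _ L γ) hγ]
    exact (h.translate_mul γ.2 hγ _).symm

/-- The module laws hold after applying the injective equivariant map to `Z`, and smoothness of the
action follows by composing with its smooth local inverse. -/
theorem isRightModule_quotient (h : G.IsTransversalLift (EZ := EZ) φ act L L' ψ) :
    letI := h.isOpenEmbedding_quotientMap.pullbackChartedSpace (E := EZ)
    G.IsRightModule (EZ := EZ) (G.leftQuotientMap (G.returnArrows act L L' ψ) L)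
      h.quotientAct := by
  have hΦ := h.isOpenEmbedding_quotientMap
  let := hΦ.pullbackChartedSpace (E := EZ)
  have hΦs : ContMDiff 𝓘(𝕜, EZ) 𝓘(𝕜, EZ) ∞ h.quotientMap := hΦ.contMDiff_pullback
  have hφ : G.leftQuotientMap (G.returnArrows act L L' ψ) L = φ ∘ h.quotientMap :=
    funext fun w => (h.map_quotientMap w).symm
  have hmap : ∀ w γ, G.leftQuotientMap (G.returnArrows act L L' ψ) L w = G.src γ →
      G.leftQuotientMap (G.returnArrows act L L' ψ) L (h.quotientAct w γ) = G.tgt γ := by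
    intro w γ hw
    rw [← h.map_quotientMap, h.quotientMap_quotientAct hw]
    exact h.module.map_act _ _ (by rw [h.map_quotientMap, hw])
  refine ⟨?_, hmap, fun w => hΦ.injective ?_, fun w γ γ' h1 h2 => hΦ.injective ?_, ?_⟩
  · rw [hφ]
    exact h.module.smooth.comp hΦs
  · rw [h.quotientMap_quotientAct (G.src_unit _).symm, ← h.map_quotientMap, h.module.act_unit]
  · rw [h.quotientMap_quotientAct (by rw [h1, G.src_mul _ _ h2]),
      h.quotientMap_quotientAct (by rw [hmap w γ h1, h2]), h.quotientMap_quotientAct h1,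
      h.module.act_mul _ _ _ (by rw [h.map_quotientMap, h1]) h2]
  · rintro ⟨⟨w, γ⟩, hw⟩
    have hw' : φ (h.quotientMap w) = G.src γ := (h.map_quotientMap w).trans hw
    obtain ⟨g, hg, hga⟩ := h.module.smooth_act ⟨(h.quotientMap w, γ), hw'⟩
    have : Nonempty (G.LeftQuotient (G.returnArrows act L L' ψ) L) := ⟨w⟩
    have hp : ContMDiffAt (𝓘(𝕜, EZ).prod 𝓘(𝕜, EΓ)) (𝓘(𝕜, EZ).prod 𝓘(𝕜, EΓ)) ∞
        (fun q : G.LeftQuotient (G.returnArrows act L L' ψ) L × Γ => (h.quotientMap q.1, q.2))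
        (w, γ) :=
      (hΦs.contMDiffAt.comp (w, γ) contMDiffAt_fst).prodMk contMDiffAt_snd
    have hr : g (h.quotientMap w, γ) ∈ Set.range h.quotientMap :=
      ⟨h.quotientAct w γ, (h.quotientMap_quotientAct hw).trans hga.self_of_nhds.symm⟩
    refine ⟨fun q => Function.invFun h.quotientMap (g (h.quotientMap q.1, q.2)),
      ContMDiffAt.comp (w, γ) (hΦ.contMDiffAt_invFun_pullback hr)
        (ContMDiffAt.comp (w, γ) hg hp), ?_⟩
    rw [nhds_subtype_eq_comap, Filter.eventually_comap] at hga
    have h1 := hp.continuousAt.eventually hga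
    filter_upwards [continuous_subtype_val.continuousAt.eventually h1] with q h2
    have hq : φ (h.quotientMap q.1.1) = G.src q.1.2 := (h.map_quotientMap _).trans q.2
    rw [h2 ⟨(h.quotientMap q.1.1, q.1.2), hq⟩ rfl]
    simp only
    rw [← h.quotientMap_quotientAct q.2]
    exact Function.leftInverse_invFun hΦ.injective _

theorem isModuleIsoOnto_quotientMap (h : G.IsTransversalLift (EZ := EZ) φ act L L' ψ) :
    letI := h.isOpenEmbedding_quotientMap.pullbackChartedSpace (E := EZ)
    G.IsModuleIsoOnto (EZ := EZ) (G.leftQuotientMap (G.returnArrows act L L' ψ) L)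
      h.quotientAct φ act h.quotientMap (G.orbitOf φ act L') := by
  have hΦ := h.isOpenEmbedding_quotientMap
  let := hΦ.pullbackChartedSpace (E := EZ)
  rw [← h.range_quotientMap]
  exact ⟨hΦ.isOpen_range, hΦ.isDiffeoBetween_pullback, h.map_quotientMap,
    fun w γ hw => h.quotientMap_quotientAct hw⟩

/-- The hypothesis `hSo` ensures that no point of `φ⁻¹(S)` is lost in passing to the open subset, so
the inverse over `S` still has values in it. Density survives because the embedding is open. -/
theorem isResolution_quotient (h : G.IsTransversalLift (EZ := EZ) φ act L L' ψ) {S : Set M}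
    (hZ : IsResolution (EM := EM) (EZ := EZ) 𝕜 S φ) (hSo : φ ⁻¹' S ⊆ G.orbitOf φ act L') :
    letI := h.isOpenEmbedding_quotientMap.pullbackChartedSpace (E := EZ)
    IsResolution (EM := EM) (EZ := EZ) 𝕜 S
      (G.leftQuotientMap (G.returnArrows act L L' ψ) L) := by
  have hΦ := h.isOpenEmbedding_quotientMap
  let := hΦ.pullbackChartedSpace (E := EZ)
  have hφ : G.leftQuotientMap (G.returnArrows act L L' ψ) L = φ ∘ h.quotientMap :=
    funext fun w => (h.map_quotientMap w).symm
  have hs := h.isRightModule_quotient.smooth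
  rw [← h.range_quotientMap] at hSo
  obtain ⟨hbij, -, g, hg, hgs⟩ := hZ.diffeo
  have hgr : ∀ b, ∃ w, h.quotientMap w = g b := fun b => hSo (hg b).1
  choose k hk using hgr
  have hφk : ∀ b, G.leftQuotientMap (G.returnArrows act L L' ψ) L (k b) = b := fun b => by
    rw [← h.map_quotientMap, hk, (hg b).2]
  refine ⟨hs, ?_, ⟨fun w hw => hw, ?_, fun m hm => ⟨k ⟨m, hm⟩, ?_, hφk ⟨m, hm⟩⟩⟩,
    hs.smoothOnSubset _, k, fun b => ⟨?_, hφk b⟩, fun b => ?_⟩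
  · rw [hφ, Set.preimage_comp]
    exact hZ.dense.preimage hΦ.isOpenMap
  · rw [hφ]
    exact fun w hw w' hw' hww => hΦ.injective (hbij.injOn hw hw' hww)
  · rw [Set.mem_preimage, hφk ⟨m, hm⟩]
    exact hm
  · rw [Set.mem_preimage, hφk b]
    exact b.2
  · obtain ⟨f, hf, hfg⟩ := hgs b
    have : Nonempty (G.LeftQuotient (G.returnArrows act L L' ψ) L) := ⟨k b⟩
    have hr : f b ∈ Set.range h.quotientMap := ⟨k b, (hk b).trans hfg.self_of_nhds.symm⟩
    refine ⟨fun y => Function.invFun h.quotientMap (f y),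
      ContMDiffAt.comp (b : M) (hΦ.contMDiffAt_invFun_pullback hr) hf, ?_⟩
    filter_upwards [hfg] with y hy
    rw [hy, ← hk]
    exact Function.leftInverse_invFun hΦ.injective _

end Quotient

/-! ### Transversality of `L` and fullness in `S` -/

section Full

variable {S : Set M}

/-- Tangent vectors to `S` at a point of `L` decompose along the orbit and along `L`. -/
theorem tangentVectors_subset_add (h : G.IsTransversalLift (EZ := EZ) φ act L L' ψ)
    (hZ : IsResolution (EM := EM) (EZ := EZ) 𝕜 S φ) {z : Z} (hz : z ∈ L') (hzS : φ z ∈ S) :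
    tangentVectors (E := EM) 𝕜 S (φ z) ⊆
      G.baseOrbitTangentVectors (φ z) + tangentVectors (E := EM) 𝕜 L (φ z) := by
  classical
  rintro v ⟨c, hc, hcS, hcv⟩
  obtain ⟨hbij, -, g, hg, hgs⟩ := hZ.diffeo
  -- The curve in `S` is lifted by the smooth inverse of `φ` over `S`; the value `z` off `S` is a
  -- default. The lift starts at `z` since `φ` is injective over `S`.
  let k : 𝕜 → Z := fun ε => if hε : c ε ∈ S then g ⟨c ε, hε⟩ else z
  have hkc : ∀ᶠ ε in 𝓝 (0 : 𝕜), φ (k ε) = c ε := by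
    filter_upwards [hcS] with ε hε
    simp only [k, dif_pos hε]
    exact (hg _).2
  have hk : SmoothCurve (E := EZ) 𝕜 k := by
    refine hgs.contMDiffAt_comp (k := c) hc ?_
    filter_upwards [hcS] with ε hε
    exact ⟨hε, by simp only [k, dif_pos hε]⟩
  have hk0 : k 0 = z := by
    have h0 : c 0 ∈ S := hcS.self_of_nhds
    have h1 : k 0 ∈ φ ⁻¹' S := by
      rw [Set.mem_preimage, hkc.self_of_nhds]
      exact h0
    exact hbij.injOn h1 hzS (by rw [hkc.self_of_nhds, hcv.base])
  obtain ⟨w, hw⟩ := SmoothCurve.hasVelocity (E := EZ) hk0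
  have hd : MDifferentiableAt 𝓘(𝕜, EZ) 𝓘(𝕜, EM) φ z :=
    h.module.smooth.contMDiffAt.mdifferentiableAt (by simp)
  have hv : mfderiv 𝓘(𝕜, EZ) 𝓘(𝕜, EM) φ z w = v :=
    (hw.comp hk hd).unique (hcv.congr hkc)
  -- Applying `φ` to this decomposition gives the required one: `φ(z·γ) = t(γ)` turns the orbit part
  -- into a base orbit curve, and `φ` maps `L'` into `L`.
  obtain ⟨w₁, ⟨l, hl, hlL, hlv⟩, w₂, ⟨d, hd0, hds, hdφ, hdv⟩, rfl⟩ :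
      w ∈ tangentVectors (E := EZ) 𝕜 L' z + G.orbitTangentVectors φ act z := by
    rw [h.transverse _ hz]; trivial
  rw [map_add, add_comm] at hv
  have hda : SmoothCurve (E := EZ) 𝕜 fun ε => act z (d ε) :=
    h.module.contMDiffAt_act contMDiffAt_const hds (hdφ.mono fun ε hε => hε.symm)
  refine ⟨_, ⟨d, hd0, hds, hdφ, (hdv.comp hda hd).congr ?_⟩, _,
    ⟨fun ε => φ (l ε), ContMDiffAt.comp (0 : 𝕜) h.module.smooth.contMDiffAt hl,
      hlL.mono fun ε hε => h.bijOn.mapsTo hε, hlv.comp hl hd⟩, hv⟩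
  filter_upwards [hdφ] with ε hε
  exact (h.module.map_act _ _ hε.symm).symm

/-- Conversely, orbits stay in `S` by stability, and `L` lies in `S` near a common point, because
`S` is locally closed and `L ∩ S` is dense in `L`; so both summands are tangent to `S`. -/
theorem intersectsTransversally [FiniteDimensional 𝕜 EM] [IsManifold 𝓘(𝕜, EM) ∞ M]
    (h : G.IsTransversalLift (EZ := EZ) φ act L L' ψ)
    (hS : IsEmbeddedSubmanifold (E := EM) 𝕜 S) (hSG : G.IsStable S)
    (hZ : IsResolution (EM := EM) (EZ := EZ) 𝕜 S φ) (hLS : L ⊆ closure (L ∩ S)) :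
    G.IntersectsTransversally L S := by
  rintro m ⟨hmL, hmS⟩
  refine Set.Subset.antisymm ?_ ?_
  · have h1 := h.tangentVectors_subset_add hZ (h.lift_mem ⟨m, hmL⟩)
      (by rw [h.map_lift]; exact hmS)
    rwa [h.map_lift] at h1
  · rintro _ ⟨v, ⟨c, hc0, hc, hcs, hcv⟩, w, ⟨l, hl, hlL, hlw⟩, rfl⟩
    refine hS.add_mem_tangentVectors ⟨fun ε => G.tgt (c ε),
      ContMDiffAt.comp (0 : 𝕜) G.smooth_tgt.contMDiffAt hc, ?_, hcv⟩ ⟨l, hl, ?_, hlw⟩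
    · filter_upwards [hcs] with ε hε
      rw [hSG, hε]
      exact hmS
    · have h1 := hS.eventually_mem_of_mem_closure hLS hmS
      rw [← hlw.base] at h1
      filter_upwards [hlL, (ContMDiffAt.continuousAt hl).eventually h1] with ε h2 h3
      exact h3 h2

theorem isLieSubgroupoidFullIn [FiniteDimensional 𝕜 EΓ] [FiniteDimensional 𝕜 EM]
    [FiniteDimensional 𝕜 EZ] [IsManifold 𝓘(𝕜, EΓ) ∞ Γ] [IsManifold 𝓘(𝕜, EM) ∞ M]
    [IsManifold 𝓘(𝕜, EZ) ∞ Z] (h : G.IsTransversalLift (EZ := EZ) φ act L L' ψ)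
    (hS : IsEmbeddedSubmanifold (E := EM) 𝕜 S) (hSG : G.IsStable S)
    (hZ : IsResolution (EM := EM) (EZ := EZ) 𝕜 S φ) (hLS : L ⊆ closure (L ∩ S))
    (hmeet : ∀ z, φ z ∈ S → ∃ γ, G.src γ = φ z ∧ act z γ ∈ L') :
    G.IsLieSubgroupoidFullIn (G.returnArrows act L L' ψ) L S := by
  refine ⟨⟨h.isLieSubgroupoid, hLS, h.intersectsTransversally hS hSG hZ hLS, ?_⟩, ?_⟩
  · intro m hm
    obtain ⟨z, hz, rfl⟩ := hZ.diffeo.1.surjOn hm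
    obtain ⟨γ, hγ, hγL⟩ := hmeet z hm
    refine ⟨γ, hγ, ?_⟩
    rw [← h.module.map_act z γ hγ.symm]
    exact h.bijOn.mapsTo hγL
  · refine Set.inter_eq_right.2 ?_
    rintro r ⟨⟨h1, h2⟩, h3, h4⟩
    -- Fullness: `ψ(s r)·r` and `ψ(t r)` both lie over `t(r) ∈ S`, where `φ` is injective, so they
    -- coincide.
    refine h.mem_returnArrows_iff.2 ⟨h1, h3, hZ.diffeo.1.injOn ?_ ?_ ?_⟩
    · rw [Set.mem_preimage, h.map_translate]
      exact h4
    · rw [Set.mem_preimage, h.map_lift]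
      exact h4
    · rw [h.map_translate, h.map_lift]

end Full

theorem mem_orbitOf (h : G.IsTransversalLift (EZ := EZ) φ act L L' ψ) {z : Z} {γ : Γ}
    (hγ : G.src γ = φ z) (hz : act z γ ∈ L') : z ∈ G.orbitOf φ act L' :=
  ⟨act z γ, hz, G.inv γ, by rw [h.module.map_act z γ hγ.symm, G.src_inv],
    (h.module.act_act_inv hγ.symm).symm⟩

end IsTransversalLift

theorem IsCompatible.isTransversalLift {S : Set M} {φ : Z → M} {act : Z → Γ → Z} {L : Set M}
    {L' : Set Z} {ψ : L → Z} (hL' : G.IsCompatible (EZ := EZ) S φ act L L')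
    (hmod : G.IsRightModule (EZ := EZ) φ act) (hL : IsEmbeddedSubmanifold (E := EM) 𝕜 L)
    (hψ : ∀ m : L, ψ m ∈ L' ∧ φ (ψ m) = m) :
    G.IsTransversalLift (EZ := EZ) φ act L L' ψ where
  module := hmod
  base_submanifold := hL
  submanifold := hL'.submanifold
  bijOn := hL'.diffeo.1
  lift_mem m := (hψ m).1
  map_lift m := (hψ m).2
  smooth_lift := by
    obtain ⟨hbij, -, g, hg, hgs⟩ := hL'.diffeo
    -- `ψ` is given only as a pointwise inverse; injectivity of `φ` on `L'` identifies it with the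
    -- smooth one.
    have : ψ = g := funext fun m =>
      hbij.injOn (hψ m).1 (hg m).1 ((hψ m).2.trans (hg m).2.symm)
    rwa [this]
  transverse := hL'.transverse

end LieGroupoid

theorem mainTheorem4 {𝕜 : Type*} [RCLike 𝕜] {EΓ EM EZ Γ M Z : Type*}
    [NormedAddCommGroup EΓ] [NormedSpace 𝕜 EΓ] [FiniteDimensional 𝕜 EΓ]
    [NormedAddCommGroup EM] [NormedSpace 𝕜 EM] [FiniteDimensional 𝕜 EM]
    [NormedAddCommGroup EZ] [NormedSpace 𝕜 EZ] [FiniteDimensional 𝕜 EZ]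
    [TopologicalSpace Γ] [ChartedSpace EΓ Γ] [IsManifold 𝓘(𝕜, EΓ) ∞ Γ]
    [TopologicalSpace M] [ChartedSpace EM M] [IsManifold 𝓘(𝕜, EM) ∞ M]
    [TopologicalSpace Z] [ChartedSpace EZ Z] [IsManifold 𝓘(𝕜, EZ) ∞ Z] [T2Space Z]
    -- the Lie groupoid `Γ ⇉ M`, the `Γ`-stable submanifold `S`, and the `Γ`-resolution `(Z, φ)`
    (G : LieGroupoid 𝕜 (EΓ := EΓ) (EM := EM) Γ M)
    (S : Set M) (hS : IsEmbeddedSubmanifold (E := EM) 𝕜 S) (hSG : G.IsStable S)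
    (φ : Z → M) (act : Z → Γ → Z) (hZ : G.IsEquivariantResolution (EZ := EZ) S φ act)
    -- the submanifold `L`, its lift `L'` to `Z`, and the inverse `ψ` of `φ : L' → L`
    (L : Set M) (hL : IsEmbeddedSubmanifold (E := EM) 𝕜 L) (hLS : L ⊆ closure (L ∩ S))
    (L' : Set Z) (hL' : G.IsCompatible (EZ := EZ) S φ act L L')
    (ψ : L → Z) (hψ : ∀ m : L, ψ m ∈ L' ∧ φ (ψ m) = m)
    (R : Set Γ) (hR : R = G.returnArrows act L L' ψ) :
    G.IsLieSubgroupoidFullIn R L S ∧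
    G.IsClosedSubgroupoid R L ∧
    IsOpen (G.orbitOf φ act L') ∧
    ∃ (_ : ChartedSpace EZ (G.LeftQuotient R L))
      (actR : G.LeftQuotient R L → Γ → G.LeftQuotient R L),
      G.IsQuotientModule (EZ := EZ) R L actR ∧
      G.IsEquivariantResolution (EZ := EZ) S (G.leftQuotientMap R L) actR ∧
      ∃ Φ : G.LeftQuotient R L → Z,
        (∀ γ : G.srcIn L, Φ (G.toLeftQuotient R L γ) = act (ψ ⟨G.src γ, γ.2⟩) γ) ∧
        G.IsModuleIsoOnto (EZ := EZ) (G.leftQuotientMap R L) actR φ act Φ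
          (G.orbitOf φ act L') ∧
        ((∀ z : Z, ∃ γ, G.src γ = φ z ∧ act z γ ∈ L') →
          G.IsModuleIsoOnto (EZ := EZ) (G.leftQuotientMap R L) actR φ act Φ Set.univ) := by
  subst hR
  have h := hL'.isTransversalLift hZ.1 hL hψ
  have hΦ := h.isOpenEmbedding_quotientMap
  refine ⟨h.isLieSubgroupoidFullIn hS hSG hZ.2 hLS hL'.meets_orbits, h.isClosedSubgroupoid,
    by rw [← h.range_quotientMap]; exact hΦ.isOpen_range,
    hΦ.pullbackChartedSpace, h.quotientAct, h.isQuotientModule,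
    ⟨h.isRightModule_quotient, h.isResolution_quotient hZ.2 fun z hz => ?_⟩, h.quotientMap,
    fun γ => rfl, h.isModuleIsoOnto_quotientMap, fun hmeet => ?_⟩
  · obtain ⟨γ, hγ, hγL⟩ := hL'.meets_orbits z hz
    exact h.mem_orbitOf hγ hγL
  · have hU : G.orbitOf φ act L' = Set.univ := Set.eq_univ_of_forall fun z => by
      obtain ⟨γ, hγ, hγL⟩ := hmeet z
      exact h.mem_orbitOf hγ hγL
    rw [← hU]
    exact h.isModuleIsoOnto_quotientMap
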